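/- Let $p$ be a prime, $k$ an algebraic closure of $\mathbb{F}_p$, $\mathbf{F}$ a totally real number field of degree $n$ in which $p$ is unramified, and $A=\mathcal{O}_{\mathbf F}\otimes_{\mathbb Z}\mathbb{F}_p$. Let $J_0$ be the antidiagonal $n\times n$ matrix with entries $1$, let $\Psi$ be the symplectic form on $\mathbb{F}_p^{2n}$ with matrix $\left(\begin{smallmatrix}0&J_0\\-J_0&0\end{smallmatrix}\right)$, and let $G=\mathrm{GSp}(\Psi)=\mathrm{GSp}_{2n,\mathbb{F}_p}$, with cocharacter $\mu_G(t)=\mathrm{diag}(tI_n,I_n)$. Let $P,Q\subset G$ be the block lower, respectively block upper, triangular parabolic subgroups, $L=P\cap Q$, $B\subset P$ the Borel subgroup of lower triangular matrices, $T\subset B$ the diagonal torus, $W=W(G,T)$ with longest element $w_0$, $w_{0,I}$ the longest element of $W(L,T)$, $w_{\max}=w_{0,I}w_0$ and $z=\sigma(w_{0,I})w_0=w_{\max}$, where $\sigma$ is the action of Frobenius on $W$ (trivial here). Let $H$ be the $\mathbb{F}_p$-group $H(R)=\{g\in \mathrm{GL}_2(A\otimes_{\mathbb{F}_p}R)\mid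 \det g\in R^\times\}$, with cocharacter $\mu_H(t)=\mathrm{diag}(t,1)$; let $B_H$, $B_H^+$ be its Borel subgroups of lower and upper triangular matrices and $T_H=B_H\cap B_H^+$. For a zip datum $(G,P,Q,L)$ with Levi projections $\theta$ and Frobenius $\varphi$, the zip group is $E=\{(x,y)\in P\times Q\mid \varphi(\theta(x))=\theta(y)\}$, acting by $(x,y)\cdot g=xgy^{-1}$. Let $E$ be the zip group of $(G,P,Q,L)$ and $E_H$ that of $(H,B_H,B_H^+,T_H)$, and put $$H\text{-}\mathtt{Zip}=[E_H\backslash H_k],\qquad G\text{-}\mathtt{ZipFlag}=[E\backslash (G_k\times P/B)],\quad (x,y)\cdot(g,hB)=(xgy^{-1},xhB).$$ The inclusion $g\mapsto (g,1)$ identifies $G\text{-}\mathtt{ZipFlag}$ with $[E'\backslash G_k]$, $E'=E\cap(B\times G)$. For $w\in W$ the flag stratum $\mathcal{F}_{G,w}$ is the inverse image of $[B\backslash BwB/B]$ under the map $\psi\colon G\text{-}\mathtt{ZipFlag}\to[B\backslash G_k/B]$ induced by $g\mapsto gz$. The zip strata of $H\text{-}\mathtt{Zip}$ are the substacks $[E_H\backslash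 O]$ for $E_H$-orbits $O\subset H_k$; the $\mu_H$-ordinary locus is the unique open one, the stratum of the orbit of $w_{\max,H}\,z_H^{-1}=1$. Let $\gamma\colon A^2\to\mathbb{F}_p^{2n}$ be an $\mathbb{F}_p$-linear isomorphism carrying the form $((x_1,y_1),(x_2,y_2))\mapsto \mathrm{Tr}_{A/\mathbb{F}_p}(x_1y_2-x_2y_1)$ to $\Psi$, and let $u\colon H\to G$, $h\mapsto\gamma h\gamma^{-1}$, be the resulting embedding. Assume that $u\circ\mu_H=\mu_G$ and $u(B_H)\subset B$. (If $p$ splits completely in $\mathbf F$, such $\gamma$ exist.) Then $u$ induces a morphism $u_{\mathsf{flag}}\colon H\text{-}\mathtt{Zip}\to G\text{-}\mathtt{ZipFlag}$, given by $h\mapsto (u(h),1)$ and $(x,y)\mapsto(u(x),u(y))$. Proposition. The morphism $u_{\mathsf{flag}}$ maps the $\mu_H$-ordinary locus (the open zip stratum of $H\text{-}\mathtt{Zip}$) into the flag stratum $\mathcal{F}_{G,w_{\max}}$. In particular, the image of $u_{\mathsf{flag}}$ is contained in the Zariski closure $\overline{\mathcal{F}}_{G,w_{\max}}$. -/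

import Mathlib

open scoped TensorProduct NumberField

namespace ZipStack

universe u v

/-! ### Quotient stacks and their underlying topological spaces -/

/-- A group functor `Grp` acting on a functor `Spc`, both on commutative `𝔽`-algebras.  It presents the
quotient stack `[Grp \ Spc]`, the stack associated with the presheaf `R ↦ [Grp R \ Spc R]` of action
groupoids. -/
structure GroupAction (𝔽 : Type) [CommRing 𝔽] where
  Grp : ∀ (R : Type) [CommRing R] [Algebra 𝔽 R], Type u
  Spc : ∀ (R : Type) [CommRing R] [Algebra 𝔽 R], Type u
  grp : ∀ (R : Type) [CommRing R] [Algebra 𝔽 R], Group (Grp R)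
  act : ∀ (R : Type) [CommRing R] [Algebra 𝔽 R], MulAction (Grp R) (Spc R)
  grpMap : ∀ {R S : Type} [CommRing R] [Algebra 𝔽 R] [CommRing S] [Algebra 𝔽 S],
    (R →ₐ[𝔽] S) → (Grp R →* Grp S)
  spcMap : ∀ {R S : Type} [CommRing R] [Algebra 𝔽 R] [CommRing S] [Algebra 𝔽 S],
    (R →ₐ[𝔽] S) → (Spc R → Spc S)
  grpMap_id : ∀ (R : Type) [CommRing R] [Algebra 𝔽 R] (g : Grp R), grpMap (AlgHom.id 𝔽 R) g = g
  spcMap_id : ∀ (R : Type) [CommRing R] [Algebra 𝔽 R] (x : Spc R), spcMap (AlgHom.id 𝔽 R) x = x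
  grpMap_comp : ∀ {R S T : Type} [CommRing R] [Algebra 𝔽 R] [CommRing S] [Algebra 𝔽 S]
    [CommRing T] [Algebra 𝔽 T] (f : R →ₐ[𝔽] S) (f' : S →ₐ[𝔽] T) (g : Grp R),
    grpMap (f'.comp f) g = grpMap f' (grpMap f g)
  spcMap_comp : ∀ {R S T : Type} [CommRing R] [Algebra 𝔽 R] [CommRing S] [Algebra 𝔽 S]
    [CommRing T] [Algebra 𝔽 T] (f : R →ₐ[𝔽] S) (f' : S →ₐ[𝔽] T) (x : Spc R),
    spcMap (f'.comp f) x = spcMap f' (spcMap f x)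
  spcMap_smul : ∀ {R S : Type} [CommRing R] [Algebra 𝔽 R] [CommRing S] [Algebra 𝔽 S]
    (f : R →ₐ[𝔽] S) (g : Grp R) (x : Spc R), spcMap f (g • x) = grpMap f g • spcMap f x

attribute [instance] GroupAction.grp GroupAction.act

namespace GroupAction

variable {𝔽 : Type} [CommRing 𝔽]

/-- A homomorphism of group functors together with an equivariant map: it induces a morphism of
quotient stacks. -/
structure Hom (X : GroupAction.{u} 𝔽) (Y : GroupAction.{v} 𝔽) where
  onGrp : ∀ (R : Type) [CommRing R] [Algebra 𝔽 R], X.Grp R →* Y.Grp R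
  onSpc : ∀ (R : Type) [CommRing R] [Algebra 𝔽 R], X.Spc R → Y.Spc R
  equivariant : ∀ (R : Type) [CommRing R] [Algebra 𝔽 R] (g : X.Grp R) (x : X.Spc R),
    onSpc R (g • x) = onGrp R g • onSpc R x
  grp_natural : ∀ {R S : Type} [CommRing R] [Algebra 𝔽 R] [CommRing S] [Algebra 𝔽 S]
    (f : R →ₐ[𝔽] S) (g : X.Grp R), onGrp S (X.grpMap f g) = Y.grpMap f (onGrp R g)
  spc_natural : ∀ {R S : Type} [CommRing R] [Algebra 𝔽 R] [CommRing S] [Algebra 𝔽 S]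
    (f : R →ₐ[𝔽] S) (x : X.Spc R), onSpc S (X.spcMap f x) = Y.spcMap f (onSpc R x)

/-- A point of `Spc` with values in a field extension of `k`. -/
structure FieldPoint (X : GroupAction.{u} 𝔽) (k : Type) [Field k] [Algebra 𝔽 k] where
  K : Type
  [isField : Field K]
  [algBase : Algebra 𝔽 K]
  [algField : Algebra k K]
  [tower : IsScalarTower 𝔽 k K]
  pt : X.Spc K

attribute [instance] FieldPoint.isField FieldPoint.algBase FieldPoint.algField FieldPoint.tower

/-- Two field-valued points define the same point of the quotient stack over `k` if they become
isomorphic in the action groupoid of a common field extension. -/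
def FieldPoint.Rel {X : GroupAction.{u} 𝔽} {k : Type} [Field k] [Algebra 𝔽 k]
    (x y : X.FieldPoint k) : Prop :=
  ∃ (L : Type) (_ : Field L) (_ : Algebra 𝔽 L) (_ : Algebra k L) (_ : IsScalarTower 𝔽 k L)
    (i : x.K →ₐ[k] L) (j : y.K →ₐ[k] L) (g : X.Grp L),
    g • X.spcMap (i.restrictScalars 𝔽) x.pt = X.spcMap (j.restrictScalars 𝔽) y.pt

/-- The set of points of the underlying topological space of the quotient stack
`[Grp_k \ Spc_k]`: field-valued points up to isomorphism over a common extension.  (Every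
field-valued point of the quotient stack lifts to `Spc` after a field extension.) -/
def Points (X : GroupAction.{u} 𝔽) (k : Type) [Field k] [Algebra 𝔽 k] : Type (max u 1) :=
  Quot (FieldPoint.Rel (X := X) (k := k))

/-- The point of the quotient stack defined by a field-valued point of `Spc`. -/
def mkPoint (X : GroupAction.{u} 𝔽) (k : Type) [Field k] [Algebra 𝔽 k] (K : Type) [Field K]
    [Algebra 𝔽 K] [Algebra k K] [IsScalarTower 𝔽 k K] (x : X.Spc K) : X.Points k :=
  Quot.mk _ ⟨K, x⟩

/-- The map `|Spec R| → |[Grp_k \ Spc_k]|` attached to an `R`-valued point of `Spc`. -/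
noncomputable def specPoint (X : GroupAction.{u} 𝔽) (k : Type) [Field k] [Algebra 𝔽 k] (R : Type)
    [CommRing R] [Algebra 𝔽 R] [Algebra k R] [IsScalarTower 𝔽 k R] (x : X.Spc R)
    (P : PrimeSpectrum R) : X.Points k :=
  X.mkPoint k P.asIdeal.ResidueField (X.spcMap (IsScalarTower.toAlgHom 𝔽 R P.asIdeal.ResidueField) x)

/-- The topology of the underlying space of an algebraic stack: a subset is open if and only if its
inverse image under every map `|Spec R| → |[Grp_k \ Spc_k]|` given by an `R`-valued point of the
atlas `Spc` is open. -/
instance (X : GroupAction.{u} 𝔽) (k : Type) [Field k] [Algebra 𝔽 k] :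
    TopologicalSpace (X.Points k) where
  IsOpen U := ∀ (R : Type) [CommRing R] [Algebra 𝔽 R] [Algebra k R] [IsScalarTower 𝔽 k R]
    (x : X.Spc R), IsOpen (X.specPoint k R x ⁻¹' U)
  isOpen_univ := by intros; simp
  isOpen_inter := by
    intro s t hs ht R _ _ _ _ x
    exact (hs R x).inter (ht R x)
  isOpen_sUnion := by
    intro s hs R _ _ _ _ x
    rw [Set.preimage_sUnion]
    exact isOpen_biUnion fun t ht => hs t ht R x

/-- The map on underlying topological spaces induced by a morphism of quotient stacks. -/
def Hom.onPoints {X : GroupAction.{u} 𝔽} {Y : GroupAction.{v} 𝔽} (F : X.Hom Y) (k : Type) [Field k]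
    [Algebra 𝔽 k] : X.Points k → Y.Points k :=
  Quot.map (fun x => ⟨x.K, F.onSpc x.K x.pt⟩) (by
    rintro x y ⟨L, _, _, _, _, i, j, g, h⟩
    exact ⟨L, inferInstance, inferInstance, inferInstance, inferInstance, i, j, F.onGrp L g, by
      rw [← F.spc_natural, ← F.spc_natural, ← F.equivariant, h]⟩)

end GroupAction

/-! ### Parabolic subgroups, Levi projections and zip groups of matrix groups -/

section MatrixGroups

set_option linter.unusedSectionVars false

variable {m : Type} [Fintype m] [DecidableEq m] {α : Type} [LinearOrder α]
variable {S : Type u} [CommRing S]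

/-- The invertible matrices `g` with `g i j = 0` whenever `b j < b i`. -/
def triangular (S : Type u) [CommRing S] (b : m → α) : Subgroup (GL m S) where
  carrier := {g | (g : Matrix m m S).BlockTriangular b}
  mul_mem' := by
    intro x y hx hy
    simpa using Matrix.BlockTriangular.mul hx hy
  one_mem' := by simpa using Matrix.blockTriangular_one
  inv_mem' := by
    intro x hx
    have := x.invertible
    have h := Matrix.blockTriangular_inv_of_blockTriangular (M := (x : Matrix m m S)) (b := b) hx
    simpa [Matrix.coe_units_inv] using h

/-- The part of a matrix supported on the diagonal blocks. -/
def leviPart (b : m → α) (M : Matrix m m S) : Matrix m m S :=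
  Matrix.of fun i j => if b i = b j then M i j else 0

theorem leviPart_mul (b : m → α) {M N : Matrix m m S} (hM : M.BlockTriangular b)
    (hN : N.BlockTriangular b) : leviPart b (M * N) = leviPart b M * leviPart b N := by
  ext i j
  simp only [leviPart, Matrix.of_apply, Matrix.mul_apply]
  split_ifs with h
  · refine Finset.sum_congr rfl fun l _ => ?_
    rcases lt_trichotomy (b i) (b l) with hl | hl | hl
    · rw [hN (show b j < b l by rw [← h]; exact hl)]; simp
    · simp [hl, ← h]
    · rw [hM hl]; simp
  · symm
    refine Finset.sum_eq_zero fun l _ => ?_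
    by_cases h1 : b i = b l
    · rw [if_neg (fun h2 : b l = b j => h (h1.trans h2))]; simp
    · simp [h1]

theorem leviPart_one (b : m → α) : leviPart b (1 : Matrix m m S) = 1 := by
  ext i j
  by_cases h : i = j <;> simp [leviPart, Matrix.one_apply, h]

theorem leviPart_map {S' : Type v} [CommRing S'] (b : m → α) (f : S →+* S') (M : Matrix m m S) :
    leviPart b (M.map f) = (leviPart b M).map f := by
  ext i j
  simp only [leviPart, Matrix.of_apply, Matrix.map_apply]
  split_ifs <;> simp

/-- The zip group of a group of matrices `𝒢` over `S` with Frobenius `φ`, with respect to the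
cocharacter `t ↦ diag(t ^ wt i)`: pairs `(x, y)` in `P × Q` such that `φ (θ x) = θ y`.  The entry
`(i, j)` of a matrix has weight `wt i - wt j`, so that `P = P₋` is given by the vanishing of the
entries with `wt j < wt i`, and `Q = P₊` by the vanishing of the entries with `wt i < wt j`. -/
def zipGroup (𝒢 : Subgroup (GL m S)) (wt : m → ℤ) (φ : S →+* S) :
    Subgroup (GL m S × GL m S) where
  carrier := {a | (a.1 ∈ 𝒢 ∧ a.1 ∈ triangular S wt) ∧ (a.2 ∈ 𝒢 ∧ a.2 ∈ triangular S (-wt)) ∧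
    (leviPart wt (a.1 : Matrix m m S)).map φ = leviPart (-wt) (a.2 : Matrix m m S)}
  mul_mem' := by
    rintro a b ⟨⟨h1, h2⟩, ⟨h3, h4⟩, h5⟩ ⟨⟨k1, k2⟩, ⟨k3, k4⟩, k5⟩
    refine ⟨⟨mul_mem h1 k1, mul_mem h2 k2⟩, ⟨mul_mem h3 k3, mul_mem h4 k4⟩, ?_⟩
    simp only [Prod.fst_mul, Prod.snd_mul, Units.val_mul]
    rw [leviPart_mul wt h2 k2, leviPart_mul (-wt) h4 k4, Matrix.map_mul, h5, k5]
  one_mem' := by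
    refine ⟨⟨one_mem _, one_mem _⟩, ⟨one_mem _, one_mem _⟩, ?_⟩
    simp [leviPart_one]
  inv_mem' := by
    rintro a ⟨⟨h1, h2⟩, ⟨h3, h4⟩, h5⟩
    refine ⟨⟨inv_mem h1, inv_mem h2⟩, ⟨inv_mem h3, inv_mem h4⟩, ?_⟩
    have e1 : (leviPart wt ((a.1⁻¹ : GL m S) : Matrix m m S)).map φ *
        (leviPart wt (a.1 : Matrix m m S)).map φ = 1 := by
      rw [← Matrix.map_mul, ← leviPart_mul wt (inv_mem h2) h2, ← Units.val_mul]
      simp [leviPart_one]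
    have e2 : leviPart (-wt) (a.2 : Matrix m m S) *
        leviPart (-wt) ((a.2⁻¹ : GL m S) : Matrix m m S) = 1 := by
      rw [← leviPart_mul (-wt) h4 (inv_mem h4), ← Units.val_mul]
      simp [leviPart_one]
    rw [h5] at e1
    exact left_inv_eq_right_inv e1 e2

theorem triangular_map {S' : Type v} [CommRing S'] (b : m → α) (f : S →+* S') {g : GL m S}
    (h : g ∈ triangular S b) : Matrix.GeneralLinearGroup.map f g ∈ triangular S' b := by
  intro i j hij
  have := h hij
  simp [this]

theorem zipGroup_map {S' : Type v} [CommRing S'] {𝒢 : Subgroup (GL m S)} {𝒢' : Subgroup (GL m S')}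
    (wt : m → ℤ) {φ : S →+* S} {φ' : S' →+* S'} (f : S →+* S') (hφ : ∀ s, f (φ s) = φ' (f s))
    (h𝒢 : ∀ g ∈ 𝒢, Matrix.GeneralLinearGroup.map f g ∈ 𝒢') {a : GL m S × GL m S}
    (ha : a ∈ zipGroup 𝒢 wt φ) :
    (Matrix.GeneralLinearGroup.map f a.1, Matrix.GeneralLinearGroup.map f a.2) ∈
      zipGroup 𝒢' wt φ' := by
  obtain ⟨⟨h1, h2⟩, ⟨h3, h4⟩, h5⟩ := ha
  refine ⟨⟨h𝒢 _ h1, triangular_map _ f h2⟩, ⟨h𝒢 _ h3, triangular_map _ f h4⟩, ?_⟩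
  have e : ∀ g : GL m S, ((Matrix.GeneralLinearGroup.map f g : GL m S') : Matrix m m S') =
      (g : Matrix m m S).map f := fun g => rfl
  simp only [e]
  rw [leviPart_map, leviPart_map, ← h5]
  ext i j
  simp [hφ]

/-- The action `(x, y) · g = x g y⁻¹` of a zip group. -/
@[reducible]
def zipAction (𝒢 : Subgroup (GL m S)) (wt : m → ℤ) (φ : S →+* S) :
    MulAction (zipGroup 𝒢 wt φ) 𝒢 where
  smul a g := ⟨a.1.1 * g.1 * a.1.2⁻¹,
    mul_mem (mul_mem a.2.1.1 g.2) (inv_mem a.2.2.1.1)⟩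
  one_smul g := Subtype.ext (by
    change (1 : GL m S) * g.1 * (1 : GL m S)⁻¹ = g.1
    simp)
  mul_smul a b g := Subtype.ext (by
    change (a.1.1 * b.1.1) * g.1 * (a.1.2 * b.1.2)⁻¹ =
      a.1.1 * (b.1.1 * g.1 * b.1.2⁻¹) * a.1.2⁻¹
    simp [mul_assoc])

end MatrixGroups

/-- The map on invertible matrices induced by a homomorphism of algebras. -/
def glMap {m : Type} [Fintype m] [DecidableEq m] {𝔽 : Type*} [CommRing 𝔽] {R S : Type*}
    [CommRing R] [Algebra 𝔽 R] [CommRing S] [Algebra 𝔽 S] (f : R →ₐ[𝔽] S) : GL m R →* GL m S :=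
  Matrix.GeneralLinearGroup.map (f : R →+* S)

section GlMap

variable {m : Type} [Fintype m] [DecidableEq m] {𝔽 : Type*} [CommRing 𝔽] {R S T : Type*}
  [CommRing R] [Algebra 𝔽 R] [CommRing S] [Algebra 𝔽 S] [CommRing T] [Algebra 𝔽 T]

theorem glMap_apply (f : R →ₐ[𝔽] S) (g : GL m R) (i j : m) :
    (glMap f g : Matrix m m S) i j = f ((g : Matrix m m R) i j) := rfl

theorem glMap_id (g : GL m R) : glMap (AlgHom.id 𝔽 R) g = g := by
  ext; simp [glMap_apply]

theorem glMap_comp (f : R →ₐ[𝔽] S) (f' : S →ₐ[𝔽] T) (g : GL m R) :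
    glMap (f'.comp f) g = glMap f' (glMap f g) := by
  ext; simp [glMap_apply]

theorem glMap_conj (f : R →ₐ[𝔽] S) (a x b : GL m R) :
    glMap f (a * x * b⁻¹) = glMap f a * glMap f x * (glMap f b)⁻¹ := by
  rw [map_mul, map_mul, map_inv]

end GlMap

/-! ### The group `GSp` and its Weyl group -/

/-- The index set `{1, …, 2n}`: `Sum.inl` is `{1, …, n}` and `Sum.inr` is `{n + 1, …, 2n}`. -/
abbrev Idx (n : ℕ) : Type := Fin n ⊕ Fin n

/-- The matrix with ones on the antidiagonal. -/
def antidiag (n : ℕ) (R : Type u) [CommRing R] : Matrix (Fin n) (Fin n) R :=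
  Matrix.of fun i j => if j = i.rev then 1 else 0

/-- The matrix of the symplectic form `Ψ`. -/
def sympMatrix (n : ℕ) (R : Type u) [CommRing R] : Matrix (Idx n) (Idx n) R :=
  Matrix.fromBlocks 0 (antidiag n R) (-antidiag n R) 0

/-- The group `GSp_{2n}(R)` of symplectic similitudes. -/
def gsp (n : ℕ) (R : Type u) [CommRing R] : Subgroup (GL (Idx n) R) where
  carrier := {g | ∃ c : Rˣ, (g : Matrix (Idx n) (Idx n) R).transpose * sympMatrix n R * g =
    (c : R) • sympMatrix n R}
  mul_mem' := by
    rintro g h ⟨c, hc⟩ ⟨d, hd⟩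
    refine ⟨c * d, ?_⟩
    calc ((g * h : GL (Idx n) R) : Matrix (Idx n) (Idx n) R).transpose * sympMatrix n R *
          ((g * h : GL (Idx n) R) : Matrix (Idx n) (Idx n) R)
        = (h : Matrix (Idx n) (Idx n) R).transpose *
          ((g : Matrix (Idx n) (Idx n) R).transpose * sympMatrix n R * g) * h := by
          simp [Matrix.transpose_mul, Matrix.mul_assoc]
      _ = _ := by
          rw [hc, Matrix.mul_smul, Matrix.smul_mul, hd, smul_smul, Units.val_mul]
  one_mem' := ⟨1, by simp⟩
  inv_mem' := by
    rintro g ⟨c, hc⟩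
    refine ⟨c⁻¹, ?_⟩
    set M : Matrix (Idx n) (Idx n) R := (g : Matrix (Idx n) (Idx n) R) with hM
    set N : Matrix (Idx n) (Idx n) R := ((g⁻¹ : GL (Idx n) R) : Matrix (Idx n) (Idx n) R) with hN
    have h1 : M * N = 1 := by rw [hM, hN, ← Units.val_mul]; simp
    have h2 : N.transpose * M.transpose = 1 := by rw [← Matrix.transpose_mul, h1]; simp
    have h3 : sympMatrix n R = (c : R) • (N.transpose * sympMatrix n R * N) := by
      calc sympMatrix n R = (N.transpose * M.transpose) * sympMatrix n R * (M * N) := by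
            rw [h1, h2]; simp
        _ = N.transpose * (M.transpose * sympMatrix n R * M) * N := by
            simp only [Matrix.mul_assoc]
        _ = _ := by rw [hc, Matrix.mul_smul, Matrix.smul_mul]
    conv_rhs => rw [h3]
    rw [smul_smul, Units.inv_mul, one_smul]

/-- The weights of the cocharacter `μ_G(t) = diag(t, …, t, 1, …, 1)`. -/
def wtG (n : ℕ) : Idx n → ℤ := Sum.elim (fun _ => 1) (fun _ => 0)

/-- The indices in decreasing order; matrices triangular with respect to it are lower triangular. -/
def lowerIdx (n : ℕ) : Idx n → (Fin n ⊕ₗ Fin n)ᵒᵈ := fun i => OrderDual.toDual (toLex i)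

/-- The Borel subgroup `B` of lower triangular matrices in `GSp_{2n}`. -/
def borelG (n : ℕ) (R : Type u) [CommRing R] : Subgroup (GL (Idx n) R) :=
  gsp n R ⊓ triangular R (lowerIdx n)

/-- The parabolic subgroup `P` of `GSp_{2n}` attached to `μ_G`, the block lower triangular
matrices. -/
def parabolicG (n : ℕ) (R : Type u) [CommRing R] : Subgroup (GL (Idx n) R) :=
  gsp n R ⊓ triangular R (wtG n)

theorem borelG_le_parabolicG (n : ℕ) (R : Type u) [CommRing R] : borelG n R ≤ parabolicG n R := by
  rintro g ⟨h1, h2⟩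
  refine ⟨h1, ?_⟩
  intro i j hij
  apply h2
  rcases i with i | i <;> rcases j with j | j <;> simp [wtG, lowerIdx] at hij ⊢

/-- The reversal `i ↦ 2n + 1 - i` of `{1, …, 2n}`. -/
def revIdx (n : ℕ) : Equiv.Perm (Idx n) where
  toFun := Sum.elim (fun i => Sum.inr i.rev) (fun i => Sum.inl i.rev)
  invFun := Sum.elim (fun i => Sum.inr i.rev) (fun i => Sum.inl i.rev)
  left_inv := by rintro (i | i) <;> simp
  right_inv := by rintro (i | i) <;> simp

/-- The Weyl group `W` of `GSp_{2n}`: permutations with `w(i) + w(2n + 1 - i) = 2n + 1`. -/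
def weylG (n : ℕ) : Subgroup (Equiv.Perm (Idx n)) where
  carrier := {w | ∀ i, w (revIdx n i) = revIdx n (w i)}
  mul_mem' := by
    intro v w hv hw i
    simp only [Equiv.Perm.mul_apply]
    rw [hw i, hv]
  one_mem' := fun _ => rfl
  inv_mem' := by
    intro w hw i
    rw [Equiv.Perm.inv_eq_iff_eq, hw, show w (w⁻¹ i) = i from w.apply_symm_apply i]

/-- The Weyl group `W_I = W_L` of the Levi subgroup `L`: the elements of `W` stabilizing
`{1, …, n}`. -/
def weylL (n : ℕ) : Subgroup (Equiv.Perm (Idx n)) where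
  carrier := {w | w ∈ weylG n ∧ ∀ i, (w i).isLeft = i.isLeft}
  mul_mem' := by
    rintro v w ⟨hv, hv'⟩ ⟨hw, hw'⟩
    exact ⟨mul_mem hv hw, fun i => by rw [Equiv.Perm.mul_apply, hv', hw']⟩
  one_mem' := ⟨one_mem _, fun _ => rfl⟩
  inv_mem' := by
    rintro w ⟨hw, hw'⟩
    refine ⟨inv_mem hw, fun i => ?_⟩
    rw [← hw' (w⁻¹ i), show w (w⁻¹ i) = i from w.apply_symm_apply i]

/-- The length on `W`: the number of positive roots which become negative.  Positive roots
correspond to pairs `i < j` up to `(i, j) ↦ (2n + 1 - j, 2n + 1 - i)`. -/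
def weylLength {n : ℕ} (w : Equiv.Perm (Idx n)) : ℕ :=
  (Finset.univ.filter fun a : Idx n × Idx n =>
    (toLex a.1 < toLex a.2 ∧ toLex a.2 ≤ toLex (revIdx n a.1)) ∧
      toLex (w a.2) < toLex (w a.1)).card

/-- The longest element `w₀` of `W`. -/
def longestG (n : ℕ) : Equiv.Perm (Idx n) := revIdx n

/-- The longest element `w_{0,I}` of `W_I`. -/
def longestL (n : ℕ) : Equiv.Perm (Idx n) := Equiv.sumCongr Fin.revPerm Fin.revPerm

theorem lex_revIdx {n : ℕ} (i j : Idx n) :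
    toLex (revIdx n i) < toLex (revIdx n j) ↔ toLex j < toLex i := by
  rcases i with i | i <;> rcases j with j | j <;> simp [revIdx]

theorem longestG_mem (n : ℕ) : longestG n ∈ weylG n := fun _ => rfl

theorem weylLength_le_longestG (n : ℕ) (w : Equiv.Perm (Idx n)) :
    weylLength w ≤ weylLength (longestG n) := by
  apply Finset.card_le_card
  intro a
  simp only [Finset.mem_filter, Finset.mem_univ, true_and]
  rintro ⟨h, -⟩
  exact ⟨h, (lex_revIdx _ _).2 h.1⟩

theorem longestL_mem (n : ℕ) : longestL n ∈ weylL n := by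
  refine ⟨?_, ?_⟩
  · rintro (i | i) <;> simp [longestL, revIdx]
  · rintro (i | i) <;> simp [longestL]

theorem weylLength_le_longestL (n : ℕ) (w : Equiv.Perm (Idx n)) (hw : w ∈ weylL n) :
    weylLength w ≤ weylLength (longestL n) := by
  apply Finset.card_le_card
  rintro ⟨i, j⟩
  simp only [Finset.mem_filter, Finset.mem_univ, true_and]
  rintro ⟨⟨h, h'⟩, h''⟩
  refine ⟨⟨h, h'⟩, ?_⟩
  have hi := hw.2 i
  have hj := hw.2 j
  rcases i with i | i <;> rcases j with j | j
  · simpa [longestL] using h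
  · exfalso
    rcases hi' : w (Sum.inl i) with a | a <;> rcases hj' : w (Sum.inr j) with b | b <;>
      simp_all
  · simp at h
  · simpa [longestL] using h

/-- The longest element `w_max = w_{0,I} w₀` of the set of minimal length representatives of
`W_I \ W`. -/
def wMaxG (n : ℕ) : Equiv.Perm (Idx n) := longestL n * longestG n

/-- `g` is a representative of `w` in the normalizer of the diagonal torus of `GSp_{2n}`. -/
def IsLift {n : ℕ} {R : Type u} [CommRing R] (w : Equiv.Perm (Idx n)) (g : GL (Idx n) R) : Prop :=
  g ∈ gsp n R ∧ ∀ i j, i ≠ w j → (g : Matrix (Idx n) (Idx n) R) i j = 0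

/-- A representative of `z = σ(w_{0,I}) w₀`, where `σ` acts trivially on `W` since `GSp_{2n}` is
split. -/
def zDotG (n : ℕ) (R : Type u) [CommRing R] : GL (Idx n) R where
  val := Matrix.fromBlocks 0 1 (-1) 0
  inv := Matrix.fromBlocks 0 (-1) 1 0
  val_inv := by simp [Matrix.fromBlocks_multiply]
  inv_val := by simp [Matrix.fromBlocks_multiply]

theorem zDotG_isLift (n : ℕ) (R : Type u) [CommRing R] :
    IsLift (longestL n * longestG n) (zDotG n R) := by
  refine ⟨⟨1, ?_⟩, ?_⟩
  · simp [zDotG, sympMatrix, Matrix.fromBlocks_transpose, Matrix.fromBlocks_multiply]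
  · rintro (i | i) (j | j) h <;>
      simp_all [zDotG, longestL, longestG, revIdx]

theorem sympMatrix_map (n : ℕ) {R S : Type*} [CommRing R] [CommRing S] (f : R →+* S) :
    (sympMatrix n R).map f = sympMatrix n S := by
  ext (i | i) (j | j) <;> simp [sympMatrix, antidiag]

theorem gsp_map (n : ℕ) {R S : Type*} [CommRing R] [CommRing S] (f : R →+* S) (g : GL (Idx n) R)
    (hg : g ∈ gsp n R) : Matrix.GeneralLinearGroup.map f g ∈ gsp n S := by
  obtain ⟨c, hc⟩ := hg
  refine ⟨Units.map f c, ?_⟩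
  have h := congrArg (fun M => Matrix.map M f) hc
  simp only [Matrix.map_mul, sympMatrix_map] at h
  refine Eq.trans h ?_
  rw [← sympMatrix_map n f]
  ext i j
  simp

theorem borelG_map (n : ℕ) {R S : Type*} [CommRing R] [CommRing S] (f : R →+* S)
    (g : GL (Idx n) R) (hg : g ∈ borelG n R) : Matrix.GeneralLinearGroup.map f g ∈ borelG n S :=
  ⟨gsp_map n f g hg.1, triangular_map _ f hg.2⟩

theorem parabolicG_map (n : ℕ) {R S : Type*} [CommRing R] [CommRing S] (f : R →+* S)
    (g : GL (Idx n) R) (hg : g ∈ parabolicG n R) :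
    Matrix.GeneralLinearGroup.map f g ∈ parabolicG n S :=
  ⟨gsp_map n f g hg.1, triangular_map _ f hg.2⟩

theorem gsp_glMap (n : ℕ) {𝔽 : Type*} [CommRing 𝔽] {R S : Type*} [CommRing R] [Algebra 𝔽 R]
    [CommRing S] [Algebra 𝔽 S] (f : R →ₐ[𝔽] S) {g : GL (Idx n) R} (hg : g ∈ gsp n R) :
    glMap f g ∈ gsp n S :=
  gsp_map n (f : R →+* S) g hg

theorem borelG_glMap (n : ℕ) {𝔽 : Type*} [CommRing 𝔽] {R S : Type*} [CommRing R] [Algebra 𝔽 R]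
    [CommRing S] [Algebra 𝔽 S] (f : R →ₐ[𝔽] S) {g : GL (Idx n) R} (hg : g ∈ borelG n R) :
    glMap f g ∈ borelG n S :=
  borelG_map n (f : R →+* S) g hg

theorem parabolicG_glMap (n : ℕ) {𝔽 : Type*} [CommRing 𝔽] {R S : Type*} [CommRing R] [Algebra 𝔽 R]
    [CommRing S] [Algebra 𝔽 S] (f : R →ₐ[𝔽] S) {g : GL (Idx n) R} (hg : g ∈ parabolicG n R) :
    glMap f g ∈ parabolicG n S :=
  parabolicG_map n (f : R →+* S) g hg

/-! ### The stack of `GSp`-zip flags and its stratification -/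

section Siegel

variable (p : ℕ) [Fact p.Prime] (n : ℕ)

/-- The zip group `E` of `(GSp_{2n}, μ_G)` over `𝔽_p`. -/
noncomputable def zipGroupG (R : Type) [CommRing R] [Algebra (ZMod p) R] :
    Subgroup (GL (Idx n) R × GL (Idx n) R) :=
  zipGroup (gsp n R) (wtG n) (FiniteField.frobeniusAlgHom (ZMod p) R : R →+* R)

/-- The subgroup `E' = E ∩ (B × G)` of the zip group. -/
noncomputable def zipGroupG' (R : Type) [CommRing R] [Algebra (ZMod p) R] :
    Subgroup (GL (Idx n) R × GL (Idx n) R) :=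
  zipGroupG p n R ⊓ (borelG n R).prod ⊤

theorem zipGroupG_map {R S : Type} [CommRing R] [Algebra (ZMod p) R] [CommRing S]
    [Algebra (ZMod p) S] (f : R →ₐ[ZMod p] S) {a : GL (Idx n) R × GL (Idx n) R}
    (ha : a ∈ zipGroupG p n R) :
    (glMap f a.1,
      glMap f a.2) ∈ zipGroupG p n S :=
  zipGroup_map (wtG n) (f : R →+* S) (by intro s; simp) (gsp_map n (f : R →+* S)) ha

/-- The stack `G-ZipFlag = [E \ (G × P/B)]` with `(x, y) · (g, hB) = (x g y⁻¹, x h B)`, presented as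
`[(E × B) \ (G × P)]` with `((x, y), b) · (g, h) = (x g y⁻¹, x h b⁻¹)`. -/
noncomputable def zipFlagG : GroupAction.{0} (ZMod p) where
  Grp R _ _ := zipGroupG p n R × borelG n R
  Spc R _ _ := gsp n R × parabolicG n R
  grp R _ _ := inferInstance
  act R _ _ :=
    { smul := fun a x =>
        (⟨a.1.1.1 * x.1.1 * a.1.1.2⁻¹, mul_mem (mul_mem a.1.2.1.1 x.1.2) (inv_mem a.1.2.2.1.1)⟩,
          ⟨a.1.1.1 * x.2.1 * a.2.1⁻¹, mul_mem (mul_mem a.1.2.1 x.2.2)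
            (inv_mem (borelG_le_parabolicG n R a.2.2))⟩)
      one_smul := fun x => Prod.ext
        (Subtype.ext (by
          change (1 : GL (Idx n) R) * x.1.1 * (1 : GL (Idx n) R)⁻¹ = x.1.1
          simp))
        (Subtype.ext (by
          change (1 : GL (Idx n) R) * x.2.1 * (1 : GL (Idx n) R)⁻¹ = x.2.1
          simp))
      mul_smul := fun a b x => Prod.ext
        (Subtype.ext (by
          change (a.1.1.1 * b.1.1.1) * x.1.1 * (a.1.1.2 * b.1.1.2)⁻¹ =
            a.1.1.1 * (b.1.1.1 * x.1.1 * b.1.1.2⁻¹) * a.1.1.2⁻¹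
          simp [mul_assoc]))
        (Subtype.ext (by
          change (a.1.1.1 * b.1.1.1) * x.2.1 * (a.2.1 * b.2.1)⁻¹ =
            a.1.1.1 * (b.1.1.1 * x.2.1 * b.2.1⁻¹) * a.2.1⁻¹
          simp [mul_assoc])) }
  grpMap f :=
    { toFun := fun a => (⟨_, zipGroupG_map p n f a.1.2⟩, ⟨_, borelG_glMap n f a.2.2⟩)
      map_one' := by
        refine Prod.ext (Subtype.ext (Prod.ext ?_ ?_)) (Subtype.ext ?_) <;> exact map_one _
      map_mul' := by
        intro a b
        refine Prod.ext (Subtype.ext (Prod.ext ?_ ?_)) (Subtype.ext ?_) <;> exact map_mul _ _ _ }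
  spcMap f x := (⟨_, gsp_glMap n f x.1.2⟩, ⟨_, parabolicG_glMap n f x.2.2⟩)
  grpMap_id R _ _ a := by
    refine Prod.ext (Subtype.ext (Prod.ext ?_ ?_)) (Subtype.ext ?_) <;> exact glMap_id (𝔽 := ZMod p) _
  spcMap_id R _ _ a := by
    refine Prod.ext (Subtype.ext ?_) (Subtype.ext ?_) <;> exact glMap_id (𝔽 := ZMod p) _
  grpMap_comp f f' a := by
    refine Prod.ext (Subtype.ext (Prod.ext ?_ ?_)) (Subtype.ext ?_) <;> exact glMap_comp _ _ _
  spcMap_comp f f' a := by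
    refine Prod.ext (Subtype.ext ?_) (Subtype.ext ?_) <;> exact glMap_comp _ _ _
  spcMap_smul f a x := by
    exact Prod.ext (Subtype.ext (glMap_conj f a.1.1.1 x.1.1 a.1.1.2))
      (Subtype.ext (glMap_conj f a.1.1.1 x.2.1 a.2.1))

/-- The quotient stack `[E' \ G]` with `(x, y) · g = x g y⁻¹`. -/
noncomputable def zipFlagG' : GroupAction.{0} (ZMod p) where
  Grp R _ _ := zipGroupG' p n R
  Spc R _ _ := gsp n R
  grp R _ _ := inferInstance
  act R _ _ :=
    { smul := fun a x => ⟨a.1.1 * x.1 * a.1.2⁻¹,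
        mul_mem (mul_mem a.2.1.1.1 x.2) (inv_mem (S := Subgroup (GL (Idx n) R)) a.2.1.2.1.1)⟩
      one_smul := fun x => Subtype.ext (by
        change (1 : GL (Idx n) R) * x.1 * (1 : GL (Idx n) R)⁻¹ = x.1
        simp)
      mul_smul := fun a b x => Subtype.ext (by
        change (a.1.1 * b.1.1) * x.1 * (a.1.2 * b.1.2)⁻¹ = a.1.1 * (b.1.1 * x.1 * b.1.2⁻¹) * a.1.2⁻¹
        simp [mul_assoc]) }
  grpMap f :=
    { toFun := fun a => ⟨_, zipGroupG_map p n f a.2.1, borelG_glMap n f a.2.2.1, trivial⟩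
      map_one' := by
        refine Subtype.ext (Prod.ext ?_ ?_) <;> exact map_one _
      map_mul' := by
        intro a b
        refine Subtype.ext (Prod.ext ?_ ?_) <;> exact map_mul _ _ _ }
  spcMap f x := ⟨_, gsp_glMap n f x.2⟩
  grpMap_id R _ _ a := by
    refine Subtype.ext (Prod.ext ?_ ?_) <;> exact glMap_id (𝔽 := ZMod p) _
  spcMap_id R _ _ a := Subtype.ext (glMap_id _)
  grpMap_comp f f' a := by
    refine Subtype.ext (Prod.ext ?_ ?_) <;> exact glMap_comp _ _ _
  spcMap_comp f f' a := Subtype.ext (glMap_comp _ _ _)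
  spcMap_smul f a x :=
    Subtype.ext (glMap_conj f a.1.1 x.1 a.1.2)

/-- The isomorphism `[E' \ G] ≃ G-ZipFlag` induced by the inclusion `x ↦ (x, 1)`. -/
noncomputable def zipFlagIncl : (zipFlagG' p n).Hom (zipFlagG p n) where
  onGrp R _ _ :=
    { toFun := fun a => (⟨a.1, a.2.1⟩, ⟨a.1.1, a.2.2.1⟩)
      map_one' := rfl
      map_mul' := fun _ _ => rfl }
  onSpc R _ _ x := (x, 1)
  equivariant R _ _ a x := by
    refine Prod.ext (Subtype.ext rfl) (Subtype.ext ?_)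
    change (1 : GL (Idx n) R) = a.1.1 * 1 * a.1.1⁻¹
    simp
  grp_natural f a := rfl
  spc_natural f x := by
    refine Prod.ext rfl (Subtype.ext ?_)
    exact (map_one _).symm

/-- The Schubert stack `Sbt = [B \ G / B]`. -/
noncomputable def schubertStack : GroupAction.{0} (ZMod p) where
  Grp R _ _ := borelG n R × borelG n R
  Spc R _ _ := gsp n R
  grp R _ _ := inferInstance
  act R _ _ :=
    { smul := fun a x => ⟨a.1.1 * x.1 * a.2.1⁻¹, mul_mem (mul_mem a.1.2.1 x.2) (inv_mem a.2.2.1)⟩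
      one_smul := fun x => Subtype.ext (by
        change (1 : GL (Idx n) R) * x.1 * (1 : GL (Idx n) R)⁻¹ = x.1
        simp)
      mul_smul := fun a b x => Subtype.ext (by
        change (a.1.1 * b.1.1) * x.1 * (a.2.1 * b.2.1)⁻¹ = a.1.1 * (b.1.1 * x.1 * b.2.1⁻¹) * a.2.1⁻¹
        simp [mul_assoc]) }
  grpMap f :=
    { toFun := fun a => (⟨_, borelG_glMap n f a.1.2⟩,
        ⟨_, borelG_glMap n f a.2.2⟩)
      map_one' := by
        refine Prod.ext (Subtype.ext ?_) (Subtype.ext ?_) <;> exact map_one _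
      map_mul' := by
        intro a b
        refine Prod.ext (Subtype.ext ?_) (Subtype.ext ?_) <;> exact map_mul _ _ _ }
  spcMap f x := ⟨_, gsp_glMap n f x.2⟩
  grpMap_id R _ _ a := by
    refine Prod.ext (Subtype.ext ?_) (Subtype.ext ?_) <;> exact glMap_id (𝔽 := ZMod p) _
  spcMap_id R _ _ a := Subtype.ext (glMap_id _)
  grpMap_comp f f' a := by
    refine Prod.ext (Subtype.ext ?_) (Subtype.ext ?_) <;> exact glMap_comp _ _ _
  spcMap_comp f f' a := Subtype.ext (glMap_comp _ _ _)
  spcMap_smul f a x :=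
    Subtype.ext (glMap_conj f a.1.1 x.1 a.2.1)

theorem conj_zDotG_mem {R : Type} [CommRing R] [Algebra (ZMod p) R]
    {a : GL (Idx n) R × GL (Idx n) R} (ha : a ∈ zipGroupG' p n R) :
    (zDotG n R)⁻¹ * a.2 * zDotG n R ∈ borelG n R := by
  obtain ⟨⟨-, ⟨h1, h2⟩, h3⟩, ⟨-, h4⟩, -⟩ := ha
  have hz := (zDotG_isLift n R).1
  refine ⟨mul_mem (mul_mem (inv_mem (S := Subgroup (GL (Idx n) R)) hz) h1) hz, ?_⟩
  set M : Matrix (Idx n) (Idx n) R := (a.2 : Matrix (Idx n) (Idx n) R) with hM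
  have e : (((zDotG n R)⁻¹ * a.2 * zDotG n R : GL (Idx n) R) : Matrix (Idx n) (Idx n) R) =
      Matrix.fromBlocks M.toBlocks₂₂ (-M.toBlocks₂₁) (-M.toBlocks₁₂) M.toBlocks₁₁ := by
    have : (((zDotG n R)⁻¹ * a.2 * zDotG n R : GL (Idx n) R) : Matrix (Idx n) (Idx n) R) =
        Matrix.fromBlocks 0 (-1) 1 0 *
          Matrix.fromBlocks M.toBlocks₁₁ M.toBlocks₁₂ M.toBlocks₂₁ M.toBlocks₂₂ *
          Matrix.fromBlocks 0 1 (-1) 0 := by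
      rw [Matrix.fromBlocks_toBlocks]; rfl
    rw [this]
    simp [Matrix.fromBlocks_multiply]
  have hlev : ∀ i j, wtG n i = wtG n j → toLex i < toLex j → M i j = 0 := by
    intro i j hij hlt
    have := congrFun (congrFun h3 i) j
    have h0 : (a.1 : Matrix (Idx n) (Idx n) R) i j = 0 := h4 hlt
    simpa [leviPart, hij, h0, (Fact.out : p.Prime).ne_zero] using this.symm
  intro i j hij
  rw [e]
  have hij' : toLex i < toLex j := hij
  rcases i with i | i <;> rcases j with j | j
  · exact hlev (Sum.inr i) (Sum.inr j) rfl (by simpa using hij')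
  · have : M (Sum.inr i) (Sum.inl j) = 0 := h2 (by simp [wtG])
    simp [Matrix.toBlocks₂₁, this]
  · simp at hij'
  · exact hlev (Sum.inl i) (Sum.inl j) rfl (by simpa using hij')

/-- The morphism `[E' \ G] → [B \ G / B]`, `g ↦ g z`, given on groups by `(x, y) ↦ (x, z⁻¹ y z)`. -/
noncomputable def toSchubert : (zipFlagG' p n).Hom (schubertStack p n) where
  onGrp R _ _ :=
    { toFun := fun a => (⟨a.1.1, a.2.2.1⟩, ⟨_, conj_zDotG_mem p n a.2⟩)
      map_one' := by
        refine Prod.ext rfl (Subtype.ext ?_)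
        change (zDotG n R)⁻¹ * 1 * zDotG n R = 1
        simp
      map_mul' := by
        intro a b
        refine Prod.ext rfl (Subtype.ext ?_)
        change (zDotG n R)⁻¹ * (a.1.2 * b.1.2) * zDotG n R =
          ((zDotG n R)⁻¹ * a.1.2 * zDotG n R) * ((zDotG n R)⁻¹ * b.1.2 * zDotG n R)
        group }
  onSpc R _ _ g := ⟨g.1 * zDotG n R, mul_mem g.2 (zDotG_isLift n R).1⟩
  equivariant R _ _ a g := by
    refine Subtype.ext ?_
    change (a.1.1 * g.1 * a.1.2⁻¹) * zDotG n R =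
      a.1.1 * (g.1 * zDotG n R) * ((zDotG n R)⁻¹ * a.1.2 * zDotG n R)⁻¹
    group
  grp_natural {R S} _ _ _ _ f a := by
    refine Prod.ext rfl (Subtype.ext ?_)
    have hz : glMap f (zDotG n R) = zDotG n S := by
      ext (i | i) (j | j) <;> simp [glMap_apply, zDotG, Matrix.one_apply]
    change (zDotG n S)⁻¹ * glMap f a.1.2 * zDotG n S =
      glMap f ((zDotG n R)⁻¹ * a.1.2 * zDotG n R)
    rw [map_mul, map_mul, map_inv, hz]
  spc_natural {R S} _ _ _ _ f g := by
    refine Subtype.ext ?_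
    have hz : glMap f (zDotG n R) = zDotG n S := by
      ext (i | i) (j | j) <;> simp [glMap_apply, zDotG, Matrix.one_apply]
    change glMap f g.1 * zDotG n S = glMap f (g.1 * zDotG n R)
    rw [map_mul, hz]

variable (k : Type) [Field k] [Algebra (ZMod p) k]

/-- The point `Sbt_w = [B \ B w B / B]` of the Schubert stack. -/
def schubertStratum (w : Equiv.Perm (Idx n)) : Set ((schubertStack p n).Points k) :=
  {s | ∃ (K : Type) (_ : Field K) (_ : Algebra (ZMod p) K) (_ : Algebra k K)
    (_ : IsScalarTower (ZMod p) k K) (b b' w' : GL (Idx n) K) (hb : b ∈ borelG n K)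
    (hb' : b' ∈ borelG n K) (hw : IsLift w w'),
    s = (schubertStack p n).mkPoint k K ⟨b * w' * b', mul_mem (mul_mem hb.1 hw.1) hb'.1⟩}

/-- The flag stratum `F_{G,w}` of `G-ZipFlag`: the inverse image of `Sbt_w` under
`ψ : G-ZipFlag ≃ [E' \ G] → Sbt`. -/
def flagStratum (w : Equiv.Perm (Idx n)) : Set ((zipFlagG p n).Points k) :=
  (zipFlagIncl p n).onPoints k '' ((toSchubert p n).onPoints k ⁻¹' schubertStratum p n k w)

end Siegel

/-! ### The Hilbert group and its embedding into `GSp` -/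

section Hilbert

variable (p : ℕ) [Fact p.Prime]

section Group

variable (A : Type u) [CommRing A] [Algebra (ZMod p) A]

/-- The homomorphism `R ⊗ A → S ⊗ A` induced by `R → S`. -/
noncomputable def tensorMap {R S : Type} [CommRing R] [Algebra (ZMod p) R] [CommRing S]
    [Algebra (ZMod p) S] (f : R →ₐ[ZMod p] S) :
    R ⊗[ZMod p] A →ₐ[ZMod p] S ⊗[ZMod p] A :=
  Algebra.TensorProduct.map f (AlgHom.id (ZMod p) A)

theorem tensorMap_id (R : Type) [CommRing R] [Algebra (ZMod p) R] :
    tensorMap p A (AlgHom.id (ZMod p) R) = AlgHom.id (ZMod p) (R ⊗[ZMod p] A) := by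
  ext <;> simp [tensorMap]

theorem tensorMap_comp {R S T : Type} [CommRing R] [Algebra (ZMod p) R] [CommRing S]
    [Algebra (ZMod p) S] [CommRing T] [Algebra (ZMod p) T] (f : R →ₐ[ZMod p] S)
    (f' : S →ₐ[ZMod p] T) :
    tensorMap p A (f'.comp f) = (tensorMap p A f').comp (tensorMap p A f) := by
  ext <;> simp [tensorMap]

/-- The group `H(R)` of matrices in `GL₂(R ⊗ A)` with determinant in `Rˣ`. -/
noncomputable def hilbertGroup (R : Type) [CommRing R] [Algebra (ZMod p) R] :
    Subgroup (GL (Fin 2) (R ⊗[ZMod p] A)) :=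
  (Units.map (algebraMap R (R ⊗[ZMod p] A) : R →* R ⊗[ZMod p] A)).range.comap
    Matrix.GeneralLinearGroup.det

/-- The weights of the cocharacter `μ_H(t) = diag(t, 1)`. -/
def wtH : Fin 2 → ℤ := ![1, 0]

/-- The relative Frobenius of `H` on `R`-valued points is induced by `frob ⊗ id` on `R ⊗ A`. -/
noncomputable def frobH (R : Type) [CommRing R] [Algebra (ZMod p) R] :
    R ⊗[ZMod p] A →ₐ[ZMod p] R ⊗[ZMod p] A :=
  tensorMap p A (FiniteField.frobeniusAlgHom (ZMod p) R)

/-- The zip group `E_H` of `(H, μ_H)`. -/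
noncomputable def zipGroupH (R : Type) [CommRing R] [Algebra (ZMod p) R] :
    Subgroup (GL (Fin 2) (R ⊗[ZMod p] A) × GL (Fin 2) (R ⊗[ZMod p] A)) :=
  zipGroup (hilbertGroup p A R) wtH (frobH p A R : R ⊗[ZMod p] A →+* R ⊗[ZMod p] A)

/-- The Borel subgroup `B_H` of lower triangular matrices in `H`. -/
noncomputable def borelH (R : Type) [CommRing R] [Algebra (ZMod p) R] :
    Subgroup (GL (Fin 2) (R ⊗[ZMod p] A)) :=
  hilbertGroup p A R ⊓ triangular _ (fun i : Fin 2 => OrderDual.toDual i)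

theorem hilbertGroup_map {R S : Type} [CommRing R] [Algebra (ZMod p) R] [CommRing S]
    [Algebra (ZMod p) S] (f : R →ₐ[ZMod p] S) {g : GL (Fin 2) (R ⊗[ZMod p] A)}
    (hg : g ∈ hilbertGroup p A R) : glMap (tensorMap p A f) g ∈ hilbertGroup p A S := by
  obtain ⟨c, hc⟩ := hg
  refine ⟨Units.map (f : R →* S) c, ?_⟩
  ext
  have h := congrArg (fun x : (R ⊗[ZMod p] A)ˣ => tensorMap p A f (x : R ⊗[ZMod p] A)) hc
  have h2 : tensorMap p A f (Matrix.det (g : Matrix (Fin 2) (Fin 2) (R ⊗[ZMod p] A))) =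
      Matrix.det (glMap (tensorMap p A f) g : Matrix (Fin 2) (Fin 2) (S ⊗[ZMod p] A)) := by
    simp [Matrix.det_fin_two, glMap_apply]
  have h3 : tensorMap p A f (algebraMap R (R ⊗[ZMod p] A) c) =
      algebraMap S (S ⊗[ZMod p] A) (f c) := by
    simp [tensorMap, Algebra.TensorProduct.algebraMap_apply]
  exact h3.symm.trans (h.trans h2)

theorem zipGroupH_map {R S : Type} [CommRing R] [Algebra (ZMod p) R] [CommRing S]
    [Algebra (ZMod p) S] (f : R →ₐ[ZMod p] S)
    {a : GL (Fin 2) (R ⊗[ZMod p] A) × GL (Fin 2) (R ⊗[ZMod p] A)} (ha : a ∈ zipGroupH p A R) :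
    (glMap (tensorMap p A f) a.1, glMap (tensorMap p A f) a.2) ∈ zipGroupH p A S := by
  refine zipGroup_map wtH (tensorMap p A f : R ⊗[ZMod p] A →+* S ⊗[ZMod p] A) ?_
    (fun g hg => hilbertGroup_map p A f hg) ha
  intro s
  have : (tensorMap p A f).comp (frobH p A R) = (frobH p A S).comp (tensorMap p A f) := by
    rw [frobH, frobH, ← tensorMap_comp, ← tensorMap_comp]
    congr 1
    ext x
    simp
  exact DFunLike.congr_fun this s

/-- The stack `H-Zip = [E_H \ H]` with `(x, y) · g = x g y⁻¹`.  As `P_H = B_H`, it coincides with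
`H-ZipFlag`. -/
noncomputable def zipH : GroupAction.{u} (ZMod p) where
  Grp R _ _ := zipGroupH p A R
  Spc R _ _ := hilbertGroup p A R
  grp R _ _ := inferInstance
  act R _ _ := zipAction _ _ _
  grpMap f :=
    { toFun := fun a => ⟨_, zipGroupH_map p A f a.2⟩
      map_one' := by
        refine Subtype.ext (Prod.ext ?_ ?_) <;> exact map_one _
      map_mul' := by
        intro a b
        refine Subtype.ext (Prod.ext ?_ ?_) <;> exact map_mul _ _ _ }
  spcMap f x := ⟨_, hilbertGroup_map p A f x.2⟩
  grpMap_id R _ _ a := by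
    refine Subtype.ext (Prod.ext ?_ ?_) <;>
    · dsimp only [MonoidHom.coe_mk, OneHom.coe_mk]
      rw [tensorMap_id, glMap_id]
  spcMap_id R _ _ a := Subtype.ext (by
    dsimp only
    rw [tensorMap_id, glMap_id])
  grpMap_comp f f' a := by
    refine Subtype.ext (Prod.ext ?_ ?_) <;>
    · dsimp only [MonoidHom.coe_mk, OneHom.coe_mk]
      rw [tensorMap_comp, glMap_comp]
  spcMap_comp f f' a := Subtype.ext (by
    dsimp only
    rw [tensorMap_comp, glMap_comp])
  spcMap_smul f a x := Subtype.ext (glMap_conj (tensorMap p A f) a.1.1 x.1 a.1.2)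

/-- A representative of the longest element `w₀` of the Weyl group of `H`. -/
noncomputable def wDotH (R : Type) [CommRing R] [Algebra (ZMod p) R] : hilbertGroup p A R :=
  ⟨⟨!![0, 1; -1, 0], !![0, -1; 1, 0], by simp [Matrix.one_fin_two], by simp [Matrix.one_fin_two]⟩,
    ⟨1, by ext; simp [Matrix.det_fin_two]⟩⟩

variable (k : Type) [Field k] [Algebra (ZMod p) k]

/-- A zip stratum of `H-Zip`: the substack `[E_H \ O]` defined by an `E_H`-orbit `O` in `H_k`. -/
def zipStratumH (h : hilbertGroup p A k) : Set ((zipH p A).Points k) :=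
  {(zipH p A).mkPoint k k h}

/-- The `μ_H`-ordinary locus of `H-Zip`: the zip stratum of the `E_H`-orbit of `w_max z⁻¹`.  Since
the Levi subgroup attached to `μ_H` is a torus, `I` is empty, `w_max = w_{0,I} w₀ = w₀` and
`z = σ(w_{0,I}) w₀ = w₀`. -/
noncomputable def ordinaryLocusH : Set ((zipH p A).Points k) :=
  zipStratumH p A k (wDotH p A k * (wDotH p A k)⁻¹)

end Group

/-- An isomorphism `γ` from `A²` with the symplectic form `Tr(x₁ y₂ - x₂ y₁)` to the standard
symplectic space `𝔽_p^{2n}`. -/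
structure SymplecticIso (n : ℕ) (A : Type u) [CommRing A] [Algebra (ZMod p) A] where
  toEquiv : (Fin 2 → A) ≃ₗ[ZMod p] (Idx n → ZMod p)
  map_form : ∀ v w : Fin 2 → A, dotProduct (toEquiv v) (Matrix.mulVec (sympMatrix n (ZMod p)) (toEquiv w)) =
    Algebra.trace (ZMod p) A (v 0 * w 1 - w 0 * v 1)

namespace SymplecticIso

variable {p} {n : ℕ} {A : Type u} [CommRing A] [Algebra (ZMod p) A] (γ : SymplecticIso p n A)

/-- The `R`-basis of `(R ⊗ A)²` which `γ_R` sends to the canonical basis of `R^{2n}`. -/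
noncomputable def basis (R : Type) [CommRing R] [Algebra (ZMod p) R] :
    Module.Basis (Idx n) R (Fin 2 → R ⊗[ZMod p] A) :=
  ((Module.Basis.ofEquivFun γ.toEquiv).baseChange R).map
    (TensorProduct.piRight (ZMod p) R R (fun _ : Fin 2 => A))

/-- The matrix of `γ_R ∘ M ∘ γ_R⁻¹`, for a `2 × 2` matrix `M` over `R ⊗ A`. -/
noncomputable def conj (R : Type) [CommRing R] [Algebra (ZMod p) R] :
    Matrix (Fin 2) (Fin 2) (R ⊗[ZMod p] A) →* Matrix (Idx n) (Idx n) R where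
  toFun M := LinearMap.toMatrix (γ.basis R) (γ.basis R) ((Matrix.toLin' M).restrictScalars R)
  map_one' := by
    rw [Matrix.toLin'_one]
    exact LinearMap.toMatrix_id _
  map_mul' M N := by
    rw [Matrix.toLin'_mul, ← LinearMap.toMatrix_comp]
    rfl

/-- The embedding `u(g) = γ ∘ g ∘ γ⁻¹`. -/
noncomputable def u (R : Type) [CommRing R] [Algebra (ZMod p) R] :
    GL (Fin 2) (R ⊗[ZMod p] A) →* GL (Idx n) R :=
  Units.map (γ.conj R)

theorem basis_apply (R : Type) [CommRing R] [Algebra (ZMod p) R] (i : Idx n) (l : Fin 2) :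
    γ.basis R i l = 1 ⊗ₜ[ZMod p] (Module.Basis.ofEquivFun γ.toEquiv i l) := by
  simp [basis]

theorem tensorMap_basis {R S : Type} [CommRing R] [Algebra (ZMod p) R] [CommRing S]
    [Algebra (ZMod p) S] (f : R →ₐ[ZMod p] S) (i : Idx n) (l : Fin 2) :
    tensorMap p A f (γ.basis R i l) = γ.basis S i l := by
  simp [basis_apply, tensorMap]

theorem tensorMap_smul {R S : Type} [CommRing R] [Algebra (ZMod p) R] [CommRing S]
    [Algebra (ZMod p) S] (f : R →ₐ[ZMod p] S) (r : R) (x : R ⊗[ZMod p] A) :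
    tensorMap p A f (r • x) = f r • tensorMap p A f x := by
  rw [Algebra.smul_def, Algebra.smul_def, map_mul]
  congr 1

theorem conj_map {R S : Type} [CommRing R] [Algebra (ZMod p) R] [CommRing S]
    [Algebra (ZMod p) S] (f : R →ₐ[ZMod p] S)
    (M : Matrix (Fin 2) (Fin 2) (R ⊗[ZMod p] A)) :
    γ.conj S (M.map (tensorMap p A f)) = (γ.conj R M).map f := by
  ext i j
  have key : ∀ v : Fin 2 → R ⊗[ZMod p] A,
      (γ.basis S).repr (fun l => tensorMap p A f (v l)) i = f ((γ.basis R).repr v i) := by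
    intro v
    have hv : (fun l => tensorMap p A f (v l)) =
        ∑ j, f ((γ.basis R).repr v j) • γ.basis S j := by
      ext l
      conv_lhs => rw [← (γ.basis R).sum_repr v]
      simp [Finset.sum_apply, tensorMap_smul, tensorMap_basis]
    rw [hv, map_sum, Finsupp.finsetSum_apply, Finset.sum_eq_single i]
    · simp
    · intro j _ hj
      simp [hj]
    · simp
  simp only [conj, MonoidHom.coe_mk, OneHom.coe_mk, Matrix.map_apply, LinearMap.toMatrix_apply,
    LinearMap.coe_restrictScalars, Matrix.toLin'_apply]
  rw [← key]
  congr 2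
  ext l
  simp [Matrix.mulVec, dotProduct, tensorMap_basis]

theorem conj_smul_add (R : Type) [CommRing R] [Algebra (ZMod p) R] (r : R)
    (M N : Matrix (Fin 2) (Fin 2) (R ⊗[ZMod p] A)) :
    γ.conj R (r • M + N) = r • γ.conj R M + γ.conj R N := by
  simp only [conj, MonoidHom.coe_mk, OneHom.coe_mk]
  rw [← map_smul, ← map_add]
  congr 1
  ext v l
  simp [Matrix.toLin'_apply]

theorem u_natural {R S : Type} [CommRing R] [Algebra (ZMod p) R] [CommRing S]
    [Algebra (ZMod p) S] (f : R →ₐ[ZMod p] S) (g : GL (Fin 2) (R ⊗[ZMod p] A)) :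
    γ.u S (glMap (tensorMap p A f) g) = glMap f (γ.u R g) :=
  Units.ext (γ.conj_map f (g : Matrix (Fin 2) (Fin 2) (R ⊗[ZMod p] A)))

theorem finite (γ : SymplecticIso p n A) : Module.Finite (ZMod p) A := by
  have h : Module.Finite (ZMod p) (Fin 2 → A) := Module.Finite.equiv γ.toEquiv.symm
  exact Module.Finite.of_surjective (LinearMap.proj (R := ZMod p) (φ := fun _ : Fin 2 => A) 0)
    (LinearMap.proj_surjective 0)

/-- The symplectic form `Tr(x₁ y₂ - x₂ y₁)` over `R`. -/
noncomputable def form (A : Type u) [CommRing A] [Algebra (ZMod p) A] (R : Type) [CommRing R]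
    [Algebra (ZMod p) R] :
    (Fin 2 → R ⊗[ZMod p] A) →ₗ[R] (Fin 2 → R ⊗[ZMod p] A) →ₗ[R] R :=
  LinearMap.mk₂ R (fun v w => Algebra.trace R (R ⊗[ZMod p] A) (v 0 * w 1 - w 0 * v 1))
    (by intro v v' w; rw [← map_add]; congr 1; simp; ring)
    (by
      intro r v w
      rw [← map_smul]
      congr 1
      simp [smul_sub])
    (by intro v w w'; rw [← map_add]; congr 1; simp; ring)
    (by
      intro r v w
      rw [← map_smul]
      congr 1
      simp [smul_sub])

theorem form_basis (R : Type) [CommRing R] [Algebra (ZMod p) R] (i j : Idx n) :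
    form A R (γ.basis R i) (γ.basis R j) = sympMatrix n R i j := by
  have hfin := γ.finite
  have htr : ∀ a : A, Algebra.trace R (R ⊗[ZMod p] A) (1 ⊗ₜ[ZMod p] a) =
      algebraMap (ZMod p) R (Algebra.trace (ZMod p) A a) := by
    intro a
    rw [Algebra.trace_apply, Algebra.trace_apply, ← LinearMap.trace_baseChange]
    congr 1
    ext x
    simp
  have h := γ.map_form (Module.Basis.ofEquivFun γ.toEquiv i) (Module.Basis.ofEquivFun γ.toEquiv j)
  have h2 := congrArg (algebraMap (ZMod p) R) h
  rw [← htr] at h2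
  have h3 : ∀ i, γ.toEquiv (Module.Basis.ofEquivFun γ.toEquiv i) = Pi.single i 1 := by
    intro i
    simp
  rw [h3, h3] at h2
  have h4 : algebraMap (ZMod p) R (dotProduct (Pi.single i 1)
      (Matrix.mulVec (sympMatrix n (ZMod p)) (Pi.single j 1))) = sympMatrix n R i j := by
    rw [← sympMatrix_map n (algebraMap (ZMod p) R)]
    simp
  rw [h4] at h2
  rw [h2]
  simp [form, basis_apply, TensorProduct.tmul_sub]

theorem u_mem (R : Type) [CommRing R] [Algebra (ZMod p) R] {g : GL (Fin 2) (R ⊗[ZMod p] A)}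
    (hg : g ∈ hilbertGroup p A R) : γ.u R g ∈ gsp n R := by
  obtain ⟨c, hc⟩ := hg
  refine ⟨c, ?_⟩
  have hc' : algebraMap R (R ⊗[ZMod p] A) c =
      Matrix.det (g : Matrix (Fin 2) (Fin 2) (R ⊗[ZMod p] A)) := congrArg Units.val hc
  set M := (g : Matrix (Fin 2) (Fin 2) (R ⊗[ZMod p] A)) with hM
  have hΨ : LinearMap.toMatrix₂ (γ.basis R) (γ.basis R) (form A R) = sympMatrix n R := by
    ext i j
    rw [LinearMap.toMatrix₂_apply, form_basis]
  have hcomp : (form A R).compl₁₂ ((Matrix.toLin' M).restrictScalars R)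
      ((Matrix.toLin' M).restrictScalars R) = (c : R) • form A R := by
    refine LinearMap.ext fun v => LinearMap.ext fun w => ?_
    change Algebra.trace R (R ⊗[ZMod p] A) (Matrix.mulVec M v 0 * Matrix.mulVec M w 1 -
      Matrix.mulVec M w 0 * Matrix.mulVec M v 1) =
      (c : R) • Algebra.trace R (R ⊗[ZMod p] A) (v 0 * w 1 - w 0 * v 1)
    rw [← map_smul, Algebra.smul_def, hc', Matrix.det_fin_two]
    congr 1
    simp [Matrix.mulVec, dotProduct, Fin.sum_univ_two]
    ring
  have := LinearMap.toMatrix₂_compl₁₂ (γ.basis R) (γ.basis R) (γ.basis R) (γ.basis R) (form A R)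
    ((Matrix.toLin' M).restrictScalars R) ((Matrix.toLin' M).restrictScalars R)
  rw [hcomp, map_smul, hΨ] at this
  exact this.symm

end SymplecticIso

/-- The diagonal matrix with entries `t ^ wt i`. -/
def cocharacter {m : Type} [Fintype m] [DecidableEq m] {S : Type u} [CommRing S] (wt : m → ℤ)
    (t : Sˣ) : GL m S where
  val := Matrix.diagonal fun i => ((t ^ wt i : Sˣ) : S)
  inv := Matrix.diagonal fun i => ((t ^ (-wt i) : Sˣ) : S)
  val_inv := by
    rw [Matrix.diagonal_mul_diagonal, ← Matrix.diagonal_one]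
    congr 1
    ext i
    rw [← Units.val_mul, ← zpow_add]
    simp
  inv_val := by
    rw [Matrix.diagonal_mul_diagonal, ← Matrix.diagonal_one]
    congr 1
    ext i
    rw [← Units.val_mul, ← zpow_add]
    simp

namespace SymplecticIso

variable {p} {n : ℕ} {A : Type u} [CommRing A] [Algebra (ZMod p) A] (γ : SymplecticIso p n A)

/-- `u ∘ μ_H = μ_G`. -/
def CompatibleCocharacters : Prop :=
  ∀ (R : Type) [CommRing R] [Algebra (ZMod p) R] (t : Rˣ),
    γ.u R (cocharacter wtH (Units.map (algebraMap R (R ⊗[ZMod p] A) : R →* R ⊗[ZMod p] A) t)) =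
      cocharacter (wtG n) t

/-- `u(B_H) ⊆ B`. -/
def CompatibleBorels : Prop :=
  ∀ (R : Type) [CommRing R] [Algebra (ZMod p) R] (g : GL (Fin 2) (R ⊗[ZMod p] A)),
    g ∈ borelH p A R → γ.u R g ∈ borelG n R

variable {γ}

theorem conj_idem (hμ : γ.CompatibleCocharacters) (R : Type) [CommRing R] [Algebra (ZMod p) R] :
    γ.conj R (Matrix.diagonal ![1, 0]) = Matrix.diagonal (Sum.elim (fun _ => 1) fun _ => 0) := by
  have e : ∀ {R S : Type} [CommRing R] [Algebra (ZMod p) R] [CommRing S] [Algebra (ZMod p) S]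
      (f : R →ₐ[ZMod p] S), (Matrix.diagonal ![1, 0] : Matrix (Fin 2) (Fin 2)
        (R ⊗[ZMod p] A)).map (tensorMap p A f) = Matrix.diagonal ![1, 0] := by
    intro R S _ _ _ _ f
    ext i j
    fin_cases i <;> fin_cases j <;> simp
  have e' : ∀ {R S : Type} [CommRing R] [CommRing S] (f : R →+* S),
      (Matrix.diagonal (Sum.elim (fun _ => 1) fun _ => 0) : Matrix (Idx n) (Idx n) R).map f =
        Matrix.diagonal (Sum.elim (fun _ => 1) fun _ => 0) := by
    intro R S _ _ f
    ext (i | i) (j | j) <;> simp [Matrix.diagonal_apply]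
  have hK : γ.conj (AlgebraicClosure (ZMod p)) (Matrix.diagonal ![1, 0]) =
      Matrix.diagonal (Sum.elim (fun _ => 1) fun _ => 0) := by
    obtain ⟨t, ht⟩ : ∃ t : AlgebraicClosure (ZMod p), t ≠ 0 ∧ t ≠ 1 := by
      classical
      obtain ⟨t, ht⟩ := Infinite.exists_notMem_finset
        ({0, 1} : Finset (AlgebraicClosure (ZMod p)))
      exact ⟨t, by simpa using ht⟩
    have h := congrArg Units.val (hμ (AlgebraicClosure (ZMod p)) (Units.mk0 t ht.1))
    have h1 : (cocharacter wtH (Units.map (algebraMap (AlgebraicClosure (ZMod p))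
        (AlgebraicClosure (ZMod p) ⊗[ZMod p] A) :
          AlgebraicClosure (ZMod p) →* AlgebraicClosure (ZMod p) ⊗[ZMod p] A)
        (Units.mk0 t ht.1))).val =
        (t - 1) • (Matrix.diagonal ![1, 0] : Matrix (Fin 2) (Fin 2)
          (AlgebraicClosure (ZMod p) ⊗[ZMod p] A)) + 1 := by
      ext i j
      fin_cases i <;> fin_cases j <;> simp [cocharacter, wtH, TensorProduct.smul_tmul',
        Algebra.TensorProduct.one_def, sub_smul]
    have h2 : (cocharacter (wtG n) (Units.mk0 t ht.1)).val =
        (t - 1) • Matrix.diagonal (Sum.elim (fun _ => 1) fun _ => 0) + 1 := by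
      ext (i | i) (j | j) <;>
        simp [cocharacter, wtG, Matrix.diagonal_apply, Matrix.one_apply] <;> split_ifs <;> simp
    have h3 := h
    rw [h2] at h3
    change γ.conj _ _ = _ at h3
    rw [h1, conj_smul_add, map_one] at h3
    have h4 := add_right_cancel h3
    exact smul_right_injective _ (sub_ne_zero.2 ht.2) h4
  have h0 : γ.conj (ZMod p) (Matrix.diagonal ![1, 0]) =
      Matrix.diagonal (Sum.elim (fun _ => 1) fun _ => 0) := by
    have h := γ.conj_map (Algebra.ofId (ZMod p) (AlgebraicClosure (ZMod p)))
      (Matrix.diagonal ![1, 0])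
    rw [e, hK, ← e' (algebraMap (ZMod p) (AlgebraicClosure (ZMod p)))] at h
    ext i j
    exact ((algebraMap (ZMod p) (AlgebraicClosure (ZMod p))).injective
      (congrFun (congrFun h i) j)).symm
  have h := γ.conj_map (Algebra.ofId (ZMod p) R) (Matrix.diagonal ![1, 0])
  rw [e, h0] at h
  rw [h]
  exact e' (algebraMap (ZMod p) R)

theorem conj_idem' (hμ : γ.CompatibleCocharacters) (R : Type) [CommRing R] [Algebra (ZMod p) R] :
    γ.conj R (Matrix.diagonal ![0, 1]) = Matrix.diagonal (Sum.elim (fun _ => 0) fun _ => 1) := by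
  have h1 : (Matrix.diagonal ![0, 1] : Matrix (Fin 2) (Fin 2) (R ⊗[ZMod p] A)) =
      (-1 : R) • Matrix.diagonal ![1, 0] + 1 := by
    ext i j
    fin_cases i <;> fin_cases j <;> simp
  rw [h1, conj_smul_add, conj_idem hμ, map_one]
  ext (i | i) (j | j) <;> simp [Matrix.diagonal_apply, Matrix.one_apply]
  split_ifs <;> simp

theorem conj_block (hμ : γ.CompatibleCocharacters) (R : Type) [CommRing R] [Algebra (ZMod p) R]
    (M : Matrix (Fin 2) (Fin 2) (R ⊗[ZMod p] A)) (a b : Fin 2) (i j : Idx n) :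
    γ.conj R (Matrix.of fun c d => if c = a ∧ d = b then M c d else 0) i j =
      if wtG n i = wtH a ∧ wtG n j = wtH b then γ.conj R M i j else 0 := by
  have h : (Matrix.of fun c d => if c = a ∧ d = b then M c d else 0) =
      Matrix.diagonal (Pi.single a 1) * M * Matrix.diagonal (Pi.single b 1) := by
    ext c d
    simp only [Matrix.of_apply, Matrix.mul_diagonal, Matrix.diagonal_mul, Pi.single_apply]
    split_ifs <;> simp_all
  have h1 : ∀ a : Fin 2, γ.conj R (Matrix.diagonal (Pi.single a 1)) =
      Matrix.diagonal (fun i => if wtG n i = wtH a then 1 else 0) := by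
    intro a
    fin_cases a
    · have : (Pi.single 0 1 : Fin 2 → R ⊗[ZMod p] A) = ![1, 0] := by
        ext i; fin_cases i <;> simp
      simp only [Fin.zero_eta, this, conj_idem hμ]
      congr 1
      ext (i | i) <;> simp [wtG, wtH]
    · have : (Pi.single 1 1 : Fin 2 → R ⊗[ZMod p] A) = ![0, 1] := by
        ext i; fin_cases i <;> simp
      simp only [Fin.mk_one, this, conj_idem' hμ]
      congr 1
      ext (i | i) <;> simp [wtG, wtH]
  rw [h, map_mul, map_mul, h1, h1, Matrix.mul_diagonal, Matrix.diagonal_mul]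
  split_ifs <;> simp_all

theorem conj_triangular (hμ : γ.CompatibleCocharacters) (R : Type) [CommRing R]
    [Algebra (ZMod p) R] {M : Matrix (Fin 2) (Fin 2) (R ⊗[ZMod p] A)}
    (hM : M.BlockTriangular wtH) : (γ.conj R M).BlockTriangular (wtG n) := by
  intro i j hij
  have h := conj_block hμ R M 0 1 i j
  have h0 : (Matrix.of fun c d => if c = 0 ∧ d = 1 then M c d else 0) = (0 : R) • M + 0 := by
    ext c d
    fin_cases c <;> fin_cases d <;> simp
    exact hM (by simp [wtH])
  rw [h0, zero_smul, zero_add] at h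
  have hz : γ.conj R 0 = 0 := by
    have h1 := γ.conj_smul_add R 1 0 0
    rw [one_smul, one_smul, add_zero] at h1
    exact left_eq_add.1 h1
  rw [hz] at h
  rcases i with i | i <;> rcases j with j | j <;> simp [wtG] at hij
  simpa [wtG, wtH] using h.symm

theorem conj_triangular' (hμ : γ.CompatibleCocharacters) (R : Type) [CommRing R]
    [Algebra (ZMod p) R] {M : Matrix (Fin 2) (Fin 2) (R ⊗[ZMod p] A)}
    (hM : M.BlockTriangular (-wtH)) : (γ.conj R M).BlockTriangular (-wtG n) := by
  intro i j hij
  have h := conj_block hμ R M 1 0 i j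
  have h0 : (Matrix.of fun c d => if c = 1 ∧ d = 0 then M c d else 0) = (0 : R) • M + 0 := by
    ext c d
    fin_cases c <;> fin_cases d <;> simp
    exact hM (by simp [wtH])
  rw [h0, zero_smul, zero_add] at h
  have hz : γ.conj R 0 = 0 := by
    have h1 := γ.conj_smul_add R 1 0 0
    rw [one_smul, one_smul, add_zero] at h1
    exact left_eq_add.1 h1
  rw [hz] at h
  rcases i with i | i <;> rcases j with j | j <;> simp [wtG] at hij
  simpa [wtG, wtH] using h.symm

theorem leviPart_conj (hμ : γ.CompatibleCocharacters) (R : Type) [CommRing R]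
    [Algebra (ZMod p) R] (M : Matrix (Fin 2) (Fin 2) (R ⊗[ZMod p] A)) :
    leviPart (wtG n) (γ.conj R M) = γ.conj R (leviPart wtH M) := by
  have h : leviPart wtH M =
      (1 : R) • (Matrix.of fun c d => if c = 0 ∧ d = 0 then M c d else 0) +
        Matrix.of fun c d => if c = 1 ∧ d = 1 then M c d else 0 := by
    ext c d
    fin_cases c <;> fin_cases d <;> simp [leviPart, wtH]
  rw [h, conj_smul_add, one_smul]
  ext i j
  rw [Matrix.add_apply, conj_block hμ, conj_block hμ]
  rcases i with i | i <;> rcases j with j | j <;> simp [leviPart, wtG, wtH]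

theorem leviPart_neg {m : Type} [Fintype m] [DecidableEq m] {S : Type*} [CommRing S] (wt : m → ℤ)
    (M : Matrix m m S) : leviPart (-wt) M = leviPart wt M := by
  ext i j
  simp [leviPart]

theorem u_mem_zipGroup (hμ : γ.CompatibleCocharacters) (R : Type) [CommRing R]
    [Algebra (ZMod p) R] {a : GL (Fin 2) (R ⊗[ZMod p] A) × GL (Fin 2) (R ⊗[ZMod p] A)}
    (ha : a ∈ zipGroupH p A R) : (γ.u R a.1, γ.u R a.2) ∈ zipGroupG p n R := by
  obtain ⟨⟨h1, h2⟩, ⟨h3, h4⟩, h5⟩ := ha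
  refine ⟨⟨γ.u_mem R h1, conj_triangular hμ R h2⟩, ⟨γ.u_mem R h3, conj_triangular' hμ R h4⟩, ?_⟩
  change (leviPart (wtG n) (γ.conj R _)).map (FiniteField.frobeniusAlgHom (ZMod p) R) =
    leviPart (-wtG n) (γ.conj R _)
  rw [leviPart_neg] at h5 ⊢
  rw [leviPart_conj hμ, leviPart_conj hμ, ← h5, ← conj_map]
  rfl

theorem mem_borelH {R : Type} [CommRing R] [Algebra (ZMod p) R]
    {a : GL (Fin 2) (R ⊗[ZMod p] A) × GL (Fin 2) (R ⊗[ZMod p] A)}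
    (ha : a ∈ zipGroupH p A R) : a.1 ∈ borelH p A R := by
  obtain ⟨⟨h1, h2⟩, -, -⟩ := ha
  refine ⟨h1, ?_⟩
  intro i j hij
  have hij' : i < j := hij
  apply h2
  fin_cases i <;> fin_cases j <;> simp [wtH] at hij' ⊢

/-- The morphism `u_flag : H-Zip → G-ZipFlag`, given by `h ↦ (u(h), 1)` on spaces and by
`(x, y) ↦ ((u(x), u(y)), u(x))` on groups. -/
noncomputable def uFlag (hμ : γ.CompatibleCocharacters) (hB : γ.CompatibleBorels) :
    (zipH p A).Hom (zipFlagG p n) where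
  onGrp R _ _ :=
    { toFun := fun a => (⟨_, u_mem_zipGroup hμ R a.2⟩, ⟨_, hB R a.1.1 (mem_borelH a.2)⟩)
      map_one' := by
        refine Prod.ext (Subtype.ext (Prod.ext ?_ ?_)) (Subtype.ext ?_) <;> exact map_one (γ.u R)
      map_mul' := by
        intro a b
        refine Prod.ext (Subtype.ext (Prod.ext ?_ ?_)) (Subtype.ext ?_) <;>
          exact map_mul (γ.u R) _ _ }
  onSpc R _ _ h := (⟨_, γ.u_mem R h.2⟩, 1)
  equivariant R _ _ a h := by
    refine Prod.ext (Subtype.ext ?_) (Subtype.ext ?_)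
    · change γ.u R (a.1.1 * h.1 * a.1.2⁻¹) = γ.u R a.1.1 * γ.u R h.1 * (γ.u R a.1.2)⁻¹
      rw [map_mul, map_mul, map_inv]
    · change (1 : GL (Idx n) R) = γ.u R a.1.1 * 1 * (γ.u R a.1.1)⁻¹
      simp
  grp_natural f a := by
    refine Prod.ext (Subtype.ext (Prod.ext ?_ ?_)) (Subtype.ext ?_) <;> exact γ.u_natural f _
  spc_natural f h := by
    refine Prod.ext (Subtype.ext (γ.u_natural f _)) (Subtype.ext ?_)
    exact (map_one _).symm

end SymplecticIso

end Hilbert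

end ZipStack

/-! Call a point h of H good if its upper left entry is a unit of K ⊗ A. The whole statement rests
on two facts: good points are mapped into the flag stratum of w_max, and good points are dense in
H-Zip.

Good points land in the stratum. If h₀₀ is a unit, then h = b v with b in B_H and v upper triangular
unipotent. The pair (1, v) lies in the zip group, since both Levi parts are trivial, so h and b
define the same point of H-Zip. As u(B_H) ⊆ B, the element u(b) is in B, and ψ sends it to u(b) z,
which is in B w_max B because z represents w_max. These steps are
`one_upperUnipotentH_mem_zipGroupH`, `mkPoint_borelG_mem_flagStratum` and
`SymplecticIso.uFlag_mkPoint_mem_flagStratum`.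

Good points are dense. Through any h in H(K) passes the line c ↦ h · (1 0; c 1), whose upper left
entry is h₀₀ + c h₀₁. The first row of h generates the unit ideal of K ⊗ A, a finite K-algebra with
finitely many maximal ideals, so this entry is a unit for all but finitely many c
(`finite_not_isUnit_add_smul`). An open set containing h also contains all but finitely many points
of the line (`GroupAction.finite_eval_notMem`). When K is infinite, some c satisfies both
conditions; this is `exists_isUnit_of_isOpen`.

The ordinary point is the class of 1, which is good. An open zip stratum is a single point of the
stack, hence by density the class of a good point. The closure statement follows from density and
continuity of the map on points. No classification of the zip strata is needed. -/

namespace ZipStack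

universe u v

/-! ### Points of quotient stacks and their topology. -/

namespace GroupAction

variable {𝔽 : Type} [CommRing 𝔽] (X : GroupAction.{u} 𝔽) (k : Type) [Field k] [Algebra 𝔽 k]

/-- Points of `Spc` in the same orbit define the same point of the quotient stack. -/
theorem mkPoint_smul (K : Type) [Field K] [Algebra 𝔽 K] [Algebra k K] [IsScalarTower 𝔽 k K]
    (g : X.Grp K) (x : X.Spc K) : X.mkPoint k K (g • x) = X.mkPoint k K x := by
  refine Quot.sound ⟨K, inferInstance, inferInstance, inferInstance, inferInstance,
    AlgHom.id k K, AlgHom.id k K, g⁻¹, ?_⟩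
  have e : (AlgHom.id k K).restrictScalars 𝔽 = AlgHom.id 𝔽 K := rfl
  rw [e, X.spcMap_id, X.spcMap_id, inv_smul_smul]

/-- The point attached to the kernel of `R → K` is given by the image in `Spc K`. -/
theorem specPoint_of_ker {R K : Type} [CommRing R] [Algebra 𝔽 R] [Algebra k R]
    [IsScalarTower 𝔽 k R] [Field K] [Algebra 𝔽 K] [Algebra k K] [IsScalarTower 𝔽 k K]
    (φ : R →ₐ[k] K) (x : X.Spc R) (P : PrimeSpectrum R) (hP : P.asIdeal = RingHom.ker φ) :
    X.specPoint k R x P = X.mkPoint k K (X.spcMap (φ.restrictScalars 𝔽) x) := by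
  have hu : P.asIdeal.primeCompl ≤ (IsUnit.submonoid K).comap φ := by
    intro r hr
    have hr' : φ r ≠ 0 := fun h => hr (hP ▸ h)
    exact hr'.isUnit
  -- `K` itself serves as the common extension: the residue field of the kernel embeds into it
  -- through `φ`, and the two images of `x` then agree, so the group element is 1.
  refine Quot.sound ⟨K, inferInstance, inferInstance, inferInstance, inferInstance,
    Ideal.ResidueField.liftₐ P.asIdeal φ hP.le hu, AlgHom.id k K, 1, ?_⟩
  have e : (AlgHom.id k K).restrictScalars 𝔽 = AlgHom.id 𝔽 K := rfl
  rw [e, X.spcMap_id, one_smul]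
  change X.spcMap _ (X.spcMap _ x) = _
  rw [← X.spcMap_comp]
  congr 1
  ext r
  simp

/-- An open set containing the value at `0` of a `K[t]`-valued point contains its values at all but
finitely many elements of `K`. -/
theorem finite_eval_notMem (K : Type) [Field K] [Algebra 𝔽 K] [Algebra k K] [IsScalarTower 𝔽 k K]
    (x : X.Spc (Polynomial K)) {U : Set (X.Points k)} (hU : IsOpen U)
    (h0 : X.mkPoint k K (X.spcMap
      (((Polynomial.aeval (0 : K)).restrictScalars k).restrictScalars 𝔽) x) ∈ U) :
    {c : K | X.mkPoint k K (X.spcMap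
      (((Polynomial.aeval c).restrictScalars k).restrictScalars 𝔽) x) ∉ U}.Finite := by
  let φ : K → Polynomial K →ₐ[k] K := fun c => (Polynomial.aeval c).restrictScalars k
  -- The closed point t = c of the affine line, as the kernel of evaluation at `c`.
  let P : K → PrimeSpectrum (Polynomial K) := fun c => ⟨RingHom.ker (φ c), RingHom.ker_isPrime _⟩
  have hmem : ∀ c, X.mkPoint k K (X.spcMap ((φ c).restrictScalars 𝔽) x) ∈ U ↔
      P c ∈ X.specPoint k (Polynomial K) x ⁻¹' U := fun c => by
    rw [Set.mem_preimage, X.specPoint_of_ker k (φ c) x (P c) rfl]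
  -- The inverse image of `U` in the affine line is an open neighbourhood of t = 0, so it contains a
  -- basic open set D(f) with f(0) ≠ 0. Every exceptional `c` is then a root of the nonzero
  -- polynomial `f`.
  obtain ⟨_, ⟨f, rfl⟩, hf0, hfU⟩ :=
    PrimeSpectrum.isTopologicalBasis_basic_opens.exists_subset_of_mem_open ((hmem 0).1 h0)
      (hU (Polynomial K) x)
  have hf : f ≠ 0 := fun h => hf0 (h ▸ zero_mem _)
  refine (Polynomial.finite_setOfPred_isRoot hf).subset fun c hc => ?_
  by_contra hr
  refine hc ((hmem c).2 (hfU fun h => hr ?_))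
  simpa [P, φ, Polynomial.aeval_def, RingHom.mem_ker] using h

/-- Openness is tested along the maps from |Spec R| given by points of the atlas. By naturality, `F`
carries the test map of `x` to the test map of its image, so every test of the inverse image of `U`
is a test of `U`. -/
theorem Hom.continuous_onPoints {X : GroupAction.{u} 𝔽} {Y : GroupAction.{v} 𝔽} (F : X.Hom Y)
    (k : Type) [Field k] [Algebra 𝔽 k] : Continuous (F.onPoints k) := by
  refine ⟨fun U hU R _ _ _ _ x => ?_⟩
  have h : F.onPoints k ∘ X.specPoint k R x = Y.specPoint k R (F.onSpc R x) := by
    funext P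
    change Y.mkPoint k P.asIdeal.ResidueField _ = Y.mkPoint k P.asIdeal.ResidueField _
    rw [F.spc_natural]
  rw [← Set.preimage_comp, h]
  exact hU R (F.onSpc R x)

end GroupAction

/-! ### Units on a line in a finite algebra. -/

/-- In a finite algebra over a field, `a + c b` is a unit for all but finitely many scalars `c` if
`a` and `b` generate the unit ideal. -/
theorem finite_not_isUnit_add_smul (K : Type*) {S : Type*} [Field K] [CommRing S] [Algebra K S]
    [Module.Finite K S] {a b : S} (hab : IsCoprime a b) :
    {c : K | ¬ IsUnit (a + c • b)}.Finite := by
  have : IsArtinianRing S := IsArtinianRing.of_finite K S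
  have h : ∀ c : {c : K | ¬ IsUnit (a + c • b)}, ∃ m : MaximalSpectrum S,
      a + c.1 • b ∈ m.asIdeal := fun c => by
    obtain ⟨I, hI, hm⟩ := exists_max_ideal_of_mem_nonunits c.2
    exact ⟨⟨I, hI⟩, hm⟩
  choose m hm using h
  -- If one maximal ideal contained `a + c b` and `a + d b` with `c ≠ d`, it would contain `(c - d)
  -- b`, hence `b`, hence `a`, against coprimality. Since an Artinian ring has only finitely many
  -- maximal ideals, the exceptional scalars are finite in number.
  have hinj : Function.Injective m := by
    intro c d hcd
    by_contra hne
    have hb : (c.1 - d.1) • b ∈ (m c).asIdeal := by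
      have h1 := hm d
      rw [← hcd] at h1
      simpa [sub_smul] using sub_mem (hm c) h1
    have hb' : b ∈ (m c).asIdeal := by
      have hcd' : c.1 - d.1 ≠ 0 := sub_ne_zero.2 fun h => hne (Subtype.ext h)
      simpa [smul_smul, inv_mul_cancel₀ hcd'] using
        (m c).asIdeal.smul_of_tower_mem (c.1 - d.1)⁻¹ hb
    have ha : a ∈ (m c).asIdeal := by
      simpa using sub_mem (hm c) ((m c).asIdeal.smul_of_tower_mem c.1 hb')
    obtain ⟨x, y, hxy⟩ := hab
    exact (m c).isMaximal.ne_top ((Ideal.eq_top_iff_one _).2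
      (hxy ▸ add_mem (Ideal.mul_mem_left _ _ ha) (Ideal.mul_mem_left _ _ hb')))
  exact Finite.of_injective m hinj

/-! ### Density in H-Zip of the locus where the upper left entry is a unit. -/

section Hilbert

variable (p : ℕ) [Fact p.Prime] (A : Type u) [CommRing A] [Algebra (ZMod p) A]

/-- The lower triangular unipotent element of `H(R)` attached to `r : R`. -/
noncomputable def lowerUnipotentH (R : Type) [CommRing R] [Algebra (ZMod p) R] (r : R) :
    hilbertGroup p A R :=
  ⟨⟨!![1, 0; algebraMap R _ r, 1], !![1, 0; -algebraMap R _ r, 1],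
      by simp [Matrix.one_fin_two], by simp [Matrix.one_fin_two]⟩,
    ⟨1, by ext; simp [Matrix.det_fin_two]⟩⟩

/-- The upper triangular unipotent element of `H(R)` attached to `a : R ⊗ A`. -/
noncomputable def upperUnipotentH (R : Type) [CommRing R] [Algebra (ZMod p) R]
    (a : R ⊗[ZMod p] A) : hilbertGroup p A R :=
  ⟨⟨!![1, a; 0, 1], !![1, -a; 0, 1], by simp [Matrix.one_fin_two], by simp [Matrix.one_fin_two]⟩,
    ⟨1, by ext; simp [Matrix.det_fin_two]⟩⟩

theorem glMap_lowerUnipotentH {R S : Type} [CommRing R] [Algebra (ZMod p) R] [CommRing S]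
    [Algebra (ZMod p) S] (f : R →ₐ[ZMod p] S) (r : R) :
    glMap (tensorMap p A f) (lowerUnipotentH p A R r).1 = (lowerUnipotentH p A S (f r)).1 := by
  ext i j
  fin_cases i <;> fin_cases j <;>
    simp [glMap_apply, lowerUnipotentH, tensorMap, Algebra.TensorProduct.algebraMap_apply]

/-- The pair `(1, v)` with `v` upper triangular unipotent lies in the zip group of `H`. -/
theorem one_upperUnipotentH_mem_zipGroupH (R : Type) [CommRing R] [Algebra (ZMod p) R]
    (a : R ⊗[ZMod p] A) : (1, (upperUnipotentH p A R a).1) ∈ zipGroupH p A R := by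
  refine ⟨⟨one_mem _, one_mem _⟩, ⟨(upperUnipotentH p A R a).2, ?_⟩, ?_⟩
  · intro i j hij
    fin_cases i <;> fin_cases j <;> simp [wtH, upperUnipotentH] at hij ⊢
  -- Both Levi parts are the identity matrix, which is fixed by Frobenius.
  · ext i j
    fin_cases i <;> fin_cases j <;> simp [wtH, upperUnipotentH, leviPart]

/-- The entries in the first row of an invertible matrix generate the unit ideal. -/
theorem isCoprime_first_row {S : Type*} [CommRing S] (g : GL (Fin 2) S) :
    IsCoprime (g.1 0 0) (g.1 0 1) := by
  have h : g.1 * (g⁻¹).1 = 1 := by rw [← Units.val_mul]; simp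
  have h := congrFun (congrFun h 0) 0
  rw [Matrix.mul_apply, Fin.sum_univ_two, Matrix.one_apply_eq] at h
  exact ⟨(g⁻¹).1 0 0, (g⁻¹).1 1 0, by rw [← h]; ring⟩

/-- Every open set of `H-Zip` containing a point contains a point whose upper left entry is a
unit. -/
theorem exists_isUnit_of_isOpen [Module.Finite (ZMod p) A] (k : Type) [Field k]
    [Algebra (ZMod p) k] (K : Type) [Field K] [Infinite K] [Algebra (ZMod p) K] [Algebra k K]
    [IsScalarTower (ZMod p) k K] (h : hilbertGroup p A K) {V : Set ((zipH p A).Points k)}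
    (hV : IsOpen V) (hh : (zipH p A).mkPoint k K h ∈ V) :
    ∃ h' : hilbertGroup p A K, IsUnit (h'.1.1 0 0) ∧ (zipH p A).mkPoint k K h' ∈ V := by
  -- The affine line through `h` with parameter t. The zip group multiplies on the right by upper
  -- triangular matrices, so a lower unipotent factor can move `h` out of its orbit; it adds t times
  -- the second column of `h` to the first.
  let x : hilbertGroup p A (Polynomial K) :=
    ⟨_, hilbertGroup_map p A (IsScalarTower.toAlgHom (ZMod p) K (Polynomial K)) h.2⟩ *
      lowerUnipotentH p A _ Polynomial.X
  have hx : ∀ c : K, (zipH p A).spcMap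
      (((Polynomial.aeval (R := K) c).restrictScalars k).restrictScalars (ZMod p)) x =
        h * lowerUnipotentH p A K c := by
    intro c
    refine Subtype.ext ?_
    change glMap (tensorMap p A _) (glMap (tensorMap p A _) h.1 * _) = h.1 * _
    rw [map_mul, ← glMap_comp, ← tensorMap_comp, glMap_lowerUnipotentH]
    congr 1
    · have : ((((Polynomial.aeval (R := K) c).restrictScalars k).restrictScalars (ZMod p)).comp
          (IsScalarTower.toAlgHom (ZMod p) K (Polynomial K))) = AlgHom.id (ZMod p) K := by
        ext r
        simp
      rw [this, tensorMap_id, glMap_id]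
    · simp
  have h0 : h * lowerUnipotentH p A K 0 = h := by
    have : lowerUnipotentH p A K 0 = 1 := by
      refine Subtype.ext (Units.ext ?_)
      simp [lowerUnipotentH, Matrix.one_fin_two]
    rw [this, mul_one]
  have hfin := (zipH p A).finite_eval_notMem k K x hV (by rw [hx, h0]; exact hh)
  -- Two finite sets of parameters must be avoided: those leaving `V` and those where the upper left
  -- entry is not a unit. As `K` is infinite, some `c` avoids both.
  obtain ⟨c, hc⟩ := (hfin.union (finite_not_isUnit_add_smul K
    (isCoprime_first_row h.1))).infinite_compl.nonempty
  simp only [Set.compl_union, Set.mem_inter_iff, Set.mem_compl_iff, Set.mem_ofPred_eq,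
    not_not] at hc
  refine ⟨h * lowerUnipotentH p A K c, ?_, by rw [← hx]; exact hc.1⟩
  have e : (h * lowerUnipotentH p A K c).1.1 0 0 = h.1.1 0 0 + c • h.1.1 0 1 := by
    change (h.1.1 * (lowerUnipotentH p A K c).1.1) 0 0 = _
    simp [Matrix.mul_apply, Fin.sum_univ_two, lowerUnipotentH, Algebra.smul_def, mul_comm]
  rw [e]
  exact hc.2

/-! ### From the Borel subgroups to the flag stratum of w_max. -/

variable {p A}

/-- The points of `G-ZipFlag` given by elements of `B` lie in the flag stratum of `w_max`. -/
theorem mkPoint_borelG_mem_flagStratum (n : ℕ) (k : Type) [Field k]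
    [Algebra (ZMod p) k] (K : Type) [Field K] [Algebra (ZMod p) K] [Algebra k K]
    [IsScalarTower (ZMod p) k K] {b : GL (Idx n) K} (hb : b ∈ borelG n K) :
    (zipFlagG p n).mkPoint k K (⟨b, hb.1⟩, 1) ∈ flagStratum p n k (wMaxG n) := by
  refine ⟨(zipFlagG' p n).mkPoint k K ⟨b, hb.1⟩, ?_, rfl⟩
  -- The image under ψ is `b z`, already of the form `b w' b'` with `w' = z` and `b' = 1`, because
  -- w_max and z are the same element of the Weyl group.
  refine ⟨K, inferInstance, inferInstance, inferInstance, inferInstance, b, 1, zDotG n K, hb,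
    one_mem _, zDotG_isLift n K, ?_⟩
  change (schubertStack p n).mkPoint k K _ = _
  congr 1
  exact Subtype.ext (mul_one _).symm

/-- A point of `H` whose upper left entry is a unit is mapped into the flag stratum of `w_max`. -/
theorem SymplecticIso.uFlag_mkPoint_mem_flagStratum {n : ℕ} {γ : SymplecticIso p n A}
    (hμ : γ.CompatibleCocharacters) (hB : γ.CompatibleBorels) (k : Type) [Field k]
    [Algebra (ZMod p) k] (K : Type) [Field K] [Algebra (ZMod p) K] [Algebra k K]
    [IsScalarTower (ZMod p) k K] (h : hilbertGroup p A K) (hu : IsUnit (h.1.1 0 0)) :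
    (uFlag hμ hB).onPoints k ((zipH p A).mkPoint k K h) ∈ flagStratum p n k (wMaxG n) := by
  obtain ⟨a, ha⟩ := hu
  -- Column elimination with the unit pivot `a = h₀₀`: the upper right entry of `h v⁻¹` is h₀₁ - a ·
  -- a⁻¹ h₀₁ = 0.
  let v := upperUnipotentH p A K (↑a⁻¹ * h.1.1 0 1)
  let e : (zipH p A).Grp K := ⟨_, one_upperUnipotentH_mem_zipGroupH p A K (↑a⁻¹ * h.1.1 0 1)⟩
  have hb : (h * v⁻¹).1 ∈ borelH p A K := by
    refine ⟨(h * v⁻¹).2, ?_⟩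
    intro i j hij
    have hij' : i < j := hij
    obtain ⟨rfl, rfl⟩ : i = 0 ∧ j = 1 := by omega
    change (h.1.1 * !![1, -(↑a⁻¹ * h.1.1 0 1); 0, 1]) 0 1 = 0
    simp [Matrix.mul_apply, Fin.sum_univ_two, ← ha]
  -- The zip group element (1, v) carries `h` to `h v⁻¹`.
  have he : (zipH p A).mkPoint k K h = (zipH p A).mkPoint k K (h * v⁻¹) := by
    rw [← (zipH p A).mkPoint_smul k K e h]
    congr 1
    refine Subtype.ext ?_
    change 1 * h.1 * v.1⁻¹ = h.1 * v.1⁻¹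
    rw [one_mul]
  rw [he]
  exact mkPoint_borelG_mem_flagStratum n k K (hB K _ hb)

end Hilbert

end ZipStack

/-! ### The proposition. -/

/-- The first two claims treat the two descriptions of the ordinary locus: the stratum of the orbit
of w_max z⁻¹, and any zip stratum that is open. -/
theorem mainTheorem7 (p : ℕ) [Fact p.Prime]
    (k : Type) [Field k] [Algebra (ZMod p) k] [IsAlgClosure (ZMod p) k]
    (F : Type*) [Field F] [NumberField F] [NumberField.IsTotallyReal F]
    (hp : ¬ (p : ℤ) ∣ NumberField.discr F)
    (n : ℕ) (hn : Module.finrank ℚ F = n)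
    (γ : ZipStack.SymplecticIso p n (ZMod p ⊗[ℤ] 𝓞 F))
    (hμ : γ.CompatibleCocharacters) (hB : γ.CompatibleBorels) :
    (ZipStack.SymplecticIso.uFlag hμ hB).onPoints k ''
        ZipStack.ordinaryLocusH p (ZMod p ⊗[ℤ] 𝓞 F) k ⊆
      ZipStack.flagStratum p n k (ZipStack.wMaxG n) ∧
    (∀ h : ZipStack.hilbertGroup p (ZMod p ⊗[ℤ] 𝓞 F) k,
      IsOpen (ZipStack.zipStratumH p (ZMod p ⊗[ℤ] 𝓞 F) k h) →
        (ZipStack.SymplecticIso.uFlag hμ hB).onPoints k ''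
            ZipStack.zipStratumH p (ZMod p ⊗[ℤ] 𝓞 F) k h ⊆
          ZipStack.flagStratum p n k (ZipStack.wMaxG n)) ∧
    Set.range ((ZipStack.SymplecticIso.uFlag hμ hB).onPoints k) ⊆
      closure (ZipStack.flagStratum p n k (ZipStack.wMaxG n)) := by
  -- A is finite over 𝔽_p because γ identifies A² with 𝔽_p^{2n}; this makes K ⊗ A a finite
  -- K-algebra.
  have := γ.finite
  have := IsAlgClosure.isAlgClosed (ZMod p) (K := k)
  have hinf : Infinite k := IsAlgClosed.instInfinite
  refine ⟨?_, ?_, ?_⟩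
  · rintro _ ⟨_, rfl, rfl⟩
    refine ZipStack.SymplecticIso.uFlag_mkPoint_mem_flagStratum hμ hB k k _ ?_
    rw [mul_inv_cancel]
    simp
  · rintro h hopen _ ⟨_, rfl, rfl⟩
    -- The stratum is a single point of the stack, so the good point `h'` found in it represents
    -- that very point.
    obtain ⟨h', hu, hh'⟩ := ZipStack.exists_isUnit_of_isOpen p _ k k h hopen rfl
    rw [← (hh' : (ZipStack.zipH p _).mkPoint k k h' = _)]
    exact ZipStack.SymplecticIso.uFlag_mkPoint_mem_flagStratum hμ hB k k h' hu
  · rintro _ ⟨x, rfl⟩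
    obtain ⟨⟨K, h⟩, rfl⟩ := Quot.exists_rep x
    -- A point of the stack is represented over an arbitrary extension `K` of `k`, so density is
    -- applied over `K` rather than over `k`.
    have : Infinite K := Infinite.of_injective _ (algebraMap k K).injective
    refine mem_closure_iff.2 fun U hU hxU => ?_
    obtain ⟨h', hu, hh'⟩ := ZipStack.exists_isUnit_of_isOpen p _ k K h
      (hU.preimage ((ZipStack.SymplecticIso.uFlag hμ hB).continuous_onPoints k)) hxU
    exact ⟨_, hh', ZipStack.SymplecticIso.uFlag_mkPoint_mem_flagStratum hμ hB k K h' hu⟩
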